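/- Let $n\ge 2$ be even and let $(X_{i,j})_{i\neq j}$, $i,j\in[n]$, be independent random variables, uniform on $[0,1]$; person $i$ prefers $a$ to $b$ if $X_{i,a}<X_{i,b}$. For a perfect matching $\Pi$ of $[n]$ (regarded as a set of edges), write $\Pi(i)$ for the partner of $i$. The matching $\Pi$ is stable if for all $i\ne j$ with $\{i,j\}\notin\Pi$ we have $X_{i,\Pi(i)}<X_{i,j}$ or $X_{j,\Pi(j)}<X_{j,i}$. Write $\mathcal S$ for the set of stable matchings, and, with $x_i=X_{i,\Pi(i)}$, let $\mathcal G_\Pi$ be the event that $$\Big|\sum_i x_i-\sqrt n\Big|\le 10\log n,\quad \max_i x_i\le \frac{\log^2 n}{\sqrt n},\quad \Big|\sum_{\{i,j\}\in\Pi}x_ix_j-\tfrac12\Big|\le n^{-1/3},\quad \Big|\sum_i x_i^2-2\Big|\le n^{-1/3}.$$ **Lemma.** Fix a real $\alpha<1/4$. There is a sequence $\varepsilon_n\to0$, depending only on $\alpha$, such that the following holds for all even $n$. Let $\Pi,\Pi_1,\Pi_2$ be perfect matchings of $[n]$ such that the node sets $\{i:\Pi_1(i)\ne\Pi(i)\}$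 and $\{i:\Pi_2(i)\neq\Pi(i)\}$ are disjoint and $|\Pi_1\triangle\Pi|,\,|\Pi_2\triangle\Pi|\le n^{\alpha}$, and let $\Pi_{1,2}$ be the (unique) perfect matching with $\Pi_{1,2}\triangle\Pi=(\Pi_1\triangle\Pi)\cup(\Pi_2\triangle\Pi)$. Then $$\mathbb P\big(\Pi_1\in\mathcal S,\ \Pi_2\in\mathcal S,\ \Pi_{1,2}\notin\mathcal S,\ \mathcal G_\Pi\,\big|\,\Pi\in\mathcal S\big)\le n^{-1+2\alpha+\varepsilon_n}\;\mathbb P\big(\Pi_1\in\mathcal S,\ \mathcal G_\Pi\,\big|\,\Pi\in\mathcal S\big)\;\mathbb P\big(\Pi_2\in\mathcal S,\ \mathcal G_\Pi\,\big|\,\Pi\in\mathcal S\big).$$ -/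

import Mathlib

open MeasureTheory ProbabilityTheory Filter Topology

/-- A perfect matching of the complete graph on the vertex set `Fin n`, given by the map that sends
every vertex to its partner. (Such a matching exists only if `n` is even.) -/
@[ext]
structure PerfectMatching (n : ℕ) where
  /-- the partner of a vertex -/
  partner : Fin n → Fin n
  partner_partner : ∀ i, partner (partner i) = i
  ne_partner : ∀ i, i ≠ partner i

namespace PerfectMatching

variable {n : ℕ}

/-- The set of edges of a matching. -/
def edges (M : PerfectMatching n) : Finset (Sym2 (Fin n)) :=
  Finset.univ.image fun i => s(i, M.partner i)

/-- The set of nodes on which the matching `M₁` differs from `M`. -/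
def diffNodes (M M₁ : PerfectMatching n) : Finset (Fin n) :=
  Finset.univ.filter fun i => M₁.partner i ≠ M.partner i

theorem mem_edges (M : PerfectMatching n) (i j : Fin n) :
    s(i, j) ∈ M.edges ↔ M.partner i = j := by
  simp only [edges, Finset.mem_image, Finset.mem_univ, true_and, Sym2.eq_iff]
  constructor
  · rintro ⟨a, ⟨rfl, h⟩ | ⟨rfl, rfl⟩⟩
    · exact h
    · exact M.partner_partner _
  · rintro rfl
    exact ⟨i, Or.inl ⟨rfl, rfl⟩⟩

theorem edges_injective : Function.Injective (edges (n := n)) := by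
  intro M M' h
  ext i
  have : s(i, M'.partner i) ∈ M.edges := h ▸ (M'.mem_edges _ _).2 rfl
  rw [(M.mem_edges _ _).1 this]

/-- If `M₁` and `M₂` differ from `M` on disjoint sets of nodes, then there is exactly one matching
whose symmetric difference with `M` is the union of those of `M₁` and of `M₂`. -/
theorem existsUnique_combined (M M₁ M₂ : PerfectMatching n)
    (h : Disjoint (M.diffNodes M₁) (M.diffNodes M₂)) :
    ∃! M₁₂ : PerfectMatching n,
      symmDiff M₁₂.edges M.edges = symmDiff M₁.edges M.edges ∪ symmDiff M₂.edges M.edges := by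
  have hd : ∀ i, M₁.partner i = M.partner i ∨ M₂.partner i = M.partner i := by
    intro i
    by_contra! hc
    exact (Finset.disjoint_left.1 h : ∀ ⦃a⦄, _ → _) (show i ∈ M.diffNodes M₁ by simp [diffNodes, hc.1])
      (by simp [diffNodes, hc.2])
  have e := M.partner_partner
  have e₁ := M₁.partner_partner
  have e₂ := M₂.partner_partner
  refine ⟨⟨fun i => if M₁.partner i = M.partner i then M₂.partner i else M₁.partner i, ?_, ?_⟩,
    ?_, ?_⟩
  · intro i
    grind
  · intro i
    have := M₁.ne_partner i
    have := M₂.ne_partner i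
    grind
  · ext p
    induction p using Sym2.ind with
    | _ i j =>
      simp only [Finset.mem_symmDiff, Finset.mem_union, mem_edges]
      grind
  · intro M' hM'
    apply edges_injective
    apply symmDiff_left_injective M.edges
    refine hM'.trans ?_
    ext p
    induction p using Sym2.ind with
    | _ i j =>
      simp only [Finset.mem_symmDiff, Finset.mem_union, mem_edges]
      grind

end PerfectMatching

/-- The index set of the preference array: ordered pairs `(i, j)` with `i ≠ j`. -/
abbrev OffDiag (n : ℕ) : Type := {p : Fin n × Fin n // p.1 ≠ p.2}

/-- A preference array `(X i j)` for `i ≠ j`. Vertex `i` prefers `a` to `b` if `X i a < X i b`. -/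
abbrev PrefArray (n : ℕ) : Type := OffDiag n → ℝ

/-- The law of the random preference array: independent entries, uniform on `[0, 1]`. -/
noncomputable def prefLaw (n : ℕ) : Measure (PrefArray n) :=
  Measure.pi fun _ => (volume : Measure ℝ).restrict (Set.Icc 0 1)

instance (n : ℕ) : IsProbabilityMeasure (prefLaw n) := by
  have : IsProbabilityMeasure ((volume : Measure ℝ).restrict (Set.Icc 0 1)) := ⟨by simp⟩
  unfold prefLaw
  infer_instance

namespace PerfectMatching

variable {n : ℕ}

/-- The value `X i (M i)` that vertex `i` gives to its partner in the matching `M`. -/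
def value (M : PerfectMatching n) (X : PrefArray n) (i : Fin n) : ℝ :=
  X ⟨(i, M.partner i), M.ne_partner i⟩

/-- The event that `M` is stable: of any two distinct vertices that are not matched to each other,
at least one prefers its partner to the other vertex. -/
def stable (M : PerfectMatching n) : Set (PrefArray n) :=
  {X | ∀ (i j : Fin n) (hij : i ≠ j), M.partner i ≠ j →
    M.value X i < X ⟨(i, j), hij⟩ ∨ M.value X j < X ⟨(j, i), hij.symm⟩}

/-- The quasirandomness event on the values that the vertices give to their partners in `M`.
In the third condition every edge of `M` is counted once. -/
def quasirandom (M : PerfectMatching n) : Set (PrefArray n) :=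
  {X | |(∑ i, M.value X i) - √(n : ℝ)| ≤ 10 * Real.log n ∧
    (∀ i, M.value X i ≤ (Real.log n) ^ 2 / √(n : ℝ)) ∧
    |(∑ i with i < M.partner i, M.value X i * M.value X (M.partner i)) - 1 / 2|
      ≤ (n : ℝ) ^ (-(1 / 3) : ℝ) ∧
    |(∑ i, (M.value X i) ^ 2) - 2| ≤ (n : ℝ) ^ (-(1 / 3) : ℝ)}

/-- The conditional probability of the event `E` given that the matching `M` is stable. -/
noncomputable def condProb (M : PerfectMatching n) (E : Set (PrefArray n)) : ℝ :=
  (cond (prefLaw n) M.stable).real E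

end PerfectMatching

open Set in
/-- The uniform law on `[0, 1]`. -/
noncomputable def unitLaw : Measure ℝ := (volume : Measure ℝ).restrict (Icc 0 1)

instance : IsProbabilityMeasure unitLaw := ⟨by simp [unitLaw]⟩

theorem unitLaw_Iic {u : ℝ} (h1 : u ≤ 1) :
    unitLaw (Set.Iic u) = ENNReal.ofReal u := by
  rw [unitLaw, Measure.restrict_apply measurableSet_Iic]
  have : Set.Iic u ∩ Set.Icc 0 1 = Set.Icc 0 u := by
    ext x; simp only [Set.mem_inter_iff, Set.mem_Iic, Set.mem_Icc]
    constructor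
    · rintro ⟨a, b, c⟩; exact ⟨b, a⟩
    · rintro ⟨a, b⟩; exact ⟨b, a, b.trans h1⟩
  rw [this, Real.volume_Icc, sub_zero]

theorem unitLaw_prod_eq_restrict :
    unitLaw.prod unitLaw =
      (volume : Measure (ℝ × ℝ)).restrict (Set.Icc 0 1 ×ˢ Set.Icc 0 1) := by
  rw [unitLaw, Measure.prod_restrict]; rfl

theorem prefLaw_eq (n : ℕ) : prefLaw n = Measure.pi fun _ => unitLaw := rfl

/-- The law of a family of independent uniform pairs, one for every vertex. -/
noncomputable def pairLaw (n : ℕ) : Measure (Fin n → ℝ × ℝ) :=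
  Measure.pi fun _ => unitLaw.prod unitLaw

instance (n : ℕ) : IsProbabilityMeasure (pairLaw n) := by
  unfold pairLaw; infer_instance

theorem lintegral_pi_prod {ι : Type*} [Fintype ι] {Ω : ι → Type*} [∀ i, MeasurableSpace (Ω i)]
    (μ : ∀ i, Measure (Ω i)) [∀ i, IsProbabilityMeasure (μ i)] (f : ∀ i, Ω i → ENNReal)
    (hf : ∀ i, Measurable (f i)) :
    ∫⁻ w, ∏ i, f i (w i) ∂(Measure.pi μ) = ∏ i, ∫⁻ x, f i x ∂(μ i) := by
  have h := lintegral_prod_eq_prod_lintegral_of_indepFun (μ := Measure.pi μ) Finset.univ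
    (fun i (w : ∀ i, Ω i) => f i (w i)) (iIndepFun_pi (fun i => (hf i).aemeasurable))
    (fun i => (hf i).comp (measurable_pi_apply i))
  rw [h]
  refine Finset.prod_congr rfl fun i _ => ?_
  exact (measurePreserving_eval μ i).lintegral_comp (hf i)

namespace PerfectMatching

variable {n : ℕ}

/-- The preference array whose entries along the matching `M` are the first components of `w`, whose
entries along `N` (outside of `M`) are the second components of `w`, and whose other entries are
those of `Y`. -/
def glue (M N : PerfectMatching n) (w : Fin n → ℝ × ℝ) (Y : PrefArray n) : PrefArray n := fun p =>
  if M.partner p.1.1 = p.1.2 then (w p.1.1).1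
  else if N.partner p.1.1 = p.1.2 then (w p.1.1).2 else Y p

@[to_additive]
theorem prod_offDiag_partner {R : Type*} [CommMonoid R] (M : PerfectMatching n)
    (f : OffDiag n → R) :
    ∏ p : OffDiag n, (if M.partner p.1.1 = p.1.2 then f p else 1) =
      ∏ i, f ⟨(i, M.partner i), M.ne_partner i⟩ := by
  rw [← Finset.prod_filter]
  symm
  refine Finset.prod_bij (fun i _ => ⟨(i, M.partner i), M.ne_partner i⟩) ?_ ?_ ?_ ?_
  · intro i _; simp
  · intro i _ j _ h; simpa using congrArg (fun p : OffDiag n => p.1.1) h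
  · rintro ⟨⟨a, b⟩, hab⟩ h
    simp only [Finset.mem_filter, Finset.mem_univ, true_and] at h
    exact ⟨a, Finset.mem_univ _, by subst h; rfl⟩
  · intro i _; rfl

theorem measurable_glue (M N : PerfectMatching n) :
    Measurable fun q : (Fin n → ℝ × ℝ) × PrefArray n => M.glue N q.1 q.2 := by
  refine measurable_pi_lambda _ fun p => ?_
  unfold glue
  split_ifs <;> fun_prop

theorem measurePreserving_glue (M N : PerfectMatching n) :
    MeasurePreserving (fun q : (Fin n → ℝ × ℝ) × PrefArray n => M.glue N q.1 q.2)
      ((pairLaw n).prod (prefLaw n)) (prefLaw n) := by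
  refine ⟨measurable_glue M N, ?_⟩
  rw [prefLaw_eq]
  symm
  refine Measure.pi_eq fun s hs => ?_
  rw [Measure.map_apply (measurable_glue M N) (MeasurableSet.univ_pi hs)]
  let A : Fin n → Set ℝ := fun i => s ⟨(i, M.partner i), M.ne_partner i⟩
  let B : Fin n → Set ℝ := fun i =>
    if M.partner i = N.partner i then Set.univ else s ⟨(i, N.partner i), N.ne_partner i⟩
  let C : OffDiag n → Set ℝ := fun p =>
    if M.partner p.1.1 = p.1.2 then Set.univ
    else if N.partner p.1.1 = p.1.2 then Set.univ else s p
  have hpre : (fun q : (Fin n → ℝ × ℝ) × PrefArray n => M.glue N q.1 q.2) ⁻¹' Set.univ.pi s =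
      (Set.univ.pi fun i => A i ×ˢ B i) ×ˢ Set.univ.pi C := by
    ext ⟨w, Y⟩
    simp only [Set.mem_preimage, Set.mem_pi, Set.mem_univ, forall_const, Set.mem_prod]
    constructor
    · intro h
      refine ⟨fun i => ⟨?_, ?_⟩, fun p => ?_⟩
      · simpa [glue] using h ⟨(i, M.partner i), M.ne_partner i⟩
      · by_cases hi : M.partner i = N.partner i
        · simp [B, hi]
        · simpa [B, glue, hi] using h ⟨(i, N.partner i), N.ne_partner i⟩
      · by_cases h1 : M.partner p.1.1 = p.1.2
        · simp [C, h1]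
        by_cases h2 : N.partner p.1.1 = p.1.2
        · simp [C, h2]
        simpa [C, glue, h1, h2] using h p
    · rintro ⟨h, h'⟩ ⟨⟨a, b⟩, hab⟩
      by_cases h1 : M.partner a = b
      · subst h1
        simpa [glue] using (h a).1
      by_cases h2 : N.partner a = b
      · subst h2
        simpa [B, glue, h1] using (h a).2
      simpa [C, glue, h1, h2] using h' ⟨⟨a, b⟩, hab⟩
  rw [hpre, Measure.prod_prod, pairLaw, Measure.pi_pi, Measure.pi_pi]
  simp only [Measure.prod_prod]
  rw [Finset.prod_mul_distrib, ← prod_offDiag_partner M (fun p => unitLaw (s p))]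
  have hB : ∏ i, unitLaw (B i) = ∏ p : OffDiag n, (if N.partner p.1.1 = p.1.2 then
      (if M.partner p.1.1 = p.1.2 then 1 else unitLaw (s p)) else 1) := by
    rw [prod_offDiag_partner N (fun p => if M.partner p.1.1 = p.1.2 then 1 else unitLaw (s p))]
    refine Finset.prod_congr rfl fun i _ => ?_
    by_cases hi : M.partner i = N.partner i <;> simp [B, hi]
  rw [hB, ← Finset.prod_mul_distrib, ← Finset.prod_mul_distrib]
  refine Finset.prod_congr rfl fun p _ => ?_
  by_cases h1 : M.partner p.1.1 = p.1.2 <;> by_cases h2 : N.partner p.1.1 = p.1.2 <;>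
    simp [C, h1, h2]

end PerfectMatching

/-- Unordered pairs of distinct vertices. -/
abbrev UPair (n : ℕ) : Type := {p : Fin n × Fin n // p.1 < p.2}

/-- The two entries of a preference array that belong to an unordered pair. -/
def pairEntries {n : ℕ} (Y : PrefArray n) (p : UPair n) : ℝ × ℝ :=
  (Y ⟨(p.1.1, p.1.2), p.2.ne⟩, Y ⟨(p.1.2, p.1.1), p.2.ne'⟩)

@[to_additive]
theorem prod_offDiag_eq {R : Type*} [CommMonoid R] {n : ℕ} (f : OffDiag n → R) :
    ∏ p : OffDiag n, f p = ∏ p : UPair n,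
      (f ⟨(p.1.1, p.1.2), p.2.ne⟩ * f ⟨(p.1.2, p.1.1), p.2.ne'⟩) := by
  rw [Finset.prod_mul_distrib]
  rw [← Finset.prod_filter_mul_prod_filter_not Finset.univ (fun p : OffDiag n => p.1.1 < p.1.2)]
  congr 1
  · symm
    refine Finset.prod_bij (fun p _ => ⟨(p.1.1, p.1.2), p.2.ne⟩) ?_ ?_ ?_ ?_
    · intro p _; simpa using p.2
    · rintro ⟨⟨a, b⟩, h⟩ _ ⟨⟨c, d⟩, h'⟩ _ he; simpa using he
    · rintro ⟨⟨a, b⟩, hab⟩ h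
      exact ⟨⟨(a, b), by simpa using h⟩, Finset.mem_univ _, rfl⟩
    · intro i _; rfl
  · symm
    refine Finset.prod_bij (fun p _ => ⟨(p.1.2, p.1.1), p.2.ne'⟩) ?_ ?_ ?_ ?_
    · intro p _; simpa using p.2.le
    · rintro ⟨⟨a, b⟩, h⟩ _ ⟨⟨c, d⟩, h'⟩ _ he
      simp only [Subtype.mk.injEq, Prod.mk.injEq] at he ⊢
      exact ⟨he.2, he.1⟩
    · rintro ⟨⟨a, b⟩, hab⟩ h
      simp only [Finset.mem_filter, Finset.mem_univ, true_and, not_lt] at h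
      exact ⟨⟨(b, a), lt_of_le_of_ne h (Ne.symm hab)⟩, Finset.mem_univ _, rfl⟩
    · intro i _; rfl

theorem measurePreserving_pairEntries (n : ℕ) :
    MeasurePreserving (pairEntries (n := n)) (prefLaw n)
      (Measure.pi fun _ => unitLaw.prod unitLaw) := by
  have hm : Measurable (pairEntries (n := n)) := by
    refine measurable_pi_lambda _ fun p => ?_
    unfold pairEntries
    fun_prop
  refine ⟨hm, ?_⟩
  symm
  refine Measure.pi_eq_generateFrom (C := fun _ => Set.image2 (· ×ˢ ·) {s | MeasurableSet s} {s | MeasurableSet s})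
    (fun _ => generateFrom_prod) (fun _ => isPiSystem_prod)
    (fun _ => (Measure.FiniteSpanningSetsIn.prod unitLaw.toFiniteSpanningSetsIn
      unitLaw.toFiniteSpanningSetsIn)) ?_
  intro s hs
  choose S hS T hT hST using hs
  rw [Measure.map_apply hm (MeasurableSet.univ_pi fun p => by
    rw [← hST p]; exact MeasurableSet.prod (Set.mem_ofPred.1 (hS p)) (Set.mem_ofPred.1 (hT p)))]
  let U : OffDiag n → Set ℝ := fun p =>
    if h : p.1.1 < p.1.2 then S ⟨(p.1.1, p.1.2), h⟩ else
      if h' : p.1.2 < p.1.1 then T ⟨(p.1.2, p.1.1), h'⟩ else Set.univ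
  have hpre : pairEntries (n := n) ⁻¹' Set.univ.pi s = Set.univ.pi U := by
    ext Y
    simp only [Set.mem_preimage, Set.mem_pi, Set.mem_univ, forall_const, ← hST]
    constructor
    · rintro h ⟨⟨a, b⟩, hab⟩
      rcases lt_or_gt_of_ne hab with h1 | h1
      · simpa [U, show a < b from h1, pairEntries] using (h ⟨(a, b), h1⟩).1
      · have h1' : b < a := h1
        simpa [U, h1', h1'.not_gt, pairEntries] using (h ⟨(b, a), h1⟩).2
    · rintro h ⟨⟨a, b⟩, hab⟩
      have hab' : a < b := hab
      refine ⟨?_, ?_⟩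
      · simpa [U, hab', pairEntries] using h ⟨(a, b), hab'.ne⟩
      · simpa [U, hab', hab'.not_gt, pairEntries] using h ⟨(b, a), hab'.ne'⟩
  rw [hpre, prefLaw_eq, Measure.pi_pi, prod_offDiag_eq]
  refine Finset.prod_congr rfl fun p _ => ?_
  rw [← hST p, Measure.prod_prod]
  have := p.2
  simp [U, this, this.not_gt]

theorem unitLaw_prod_Iic {u v : ℝ} (hu : u ∈ Set.Icc (0 : ℝ) 1) (hv : v ∈ Set.Icc (0 : ℝ) 1) :
    (unitLaw.prod unitLaw) (Set.Iic u ×ˢ Set.Iic v) = ENNReal.ofReal (u * v) := by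
  rw [Measure.prod_prod, unitLaw_Iic hu.2, unitLaw_Iic hv.2, ENNReal.ofReal_mul hu.1]

theorem unitLaw_prod_Iic_compl {u v : ℝ} (hu : u ∈ Set.Icc (0 : ℝ) 1)
    (hv : v ∈ Set.Icc (0 : ℝ) 1) :
    (unitLaw.prod unitLaw) (Set.Iic u ×ˢ Set.Iic v)ᶜ = ENNReal.ofReal (1 - u * v) := by
  rw [prob_compl_eq_one_sub (measurableSet_Iic.prod measurableSet_Iic), unitLaw_prod_Iic hu hv,
    ENNReal.ofReal_sub _ (mul_nonneg hu.1 hv.1), ENNReal.ofReal_one]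

/-- The arrays in which no pair of `Q` blocks with the thresholds `u`. -/
def unblocked {n : ℕ} (Q : Finset (UPair n)) (u : Fin n → ℝ) : Set (PrefArray n) :=
  {Y | ∀ p ∈ Q, ¬((pairEntries Y p).1 ≤ u p.1.1 ∧ (pairEntries Y p).2 ≤ u p.1.2)}

/-- The arrays in which the pair `p` blocks with the thresholds `u`. -/
def blockedAt {n : ℕ} (p : UPair n) (u : Fin n → ℝ) : Set (PrefArray n) :=
  {Y | (pairEntries Y p).1 ≤ u p.1.1 ∧ (pairEntries Y p).2 ≤ u p.1.2}

theorem prefLaw_unblocked {n : ℕ} (Q : Finset (UPair n)) {u : Fin n → ℝ}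
    (hu : ∀ i, u i ∈ Set.Icc (0 : ℝ) 1) :
    prefLaw n (unblocked Q u) = ENNReal.ofReal (∏ p ∈ Q, (1 - u p.1.1 * u p.1.2)) := by
  let A : UPair n → Set (ℝ × ℝ) := fun p =>
    if p ∈ Q then (Set.Iic (u p.1.1) ×ˢ Set.Iic (u p.1.2))ᶜ else Set.univ
  have hA : unblocked Q u = pairEntries ⁻¹' Set.univ.pi A := by
    ext Y
    simp only [unblocked, Set.mem_ofPred_eq, Set.mem_preimage, Set.mem_pi, Set.mem_univ,
      forall_const]
    refine forall_congr' fun p => ?_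
    by_cases hp : p ∈ Q <;> simp [A, hp, Prod.le_def]
  have hAm : ∀ p, MeasurableSet (A p) := fun p => by
    by_cases hp : p ∈ Q
    · simp [A, hp]
    · simp [A, hp]
  rw [hA, (measurePreserving_pairEntries n).measure_preimage
    (MeasurableSet.univ_pi hAm).nullMeasurableSet, Measure.pi_pi,
    ENNReal.ofReal_prod_of_nonneg, ← Finset.prod_subset (Finset.subset_univ Q)]
  · refine Finset.prod_congr rfl fun p hp => ?_
    simp only [A, hp, if_true]
    exact unitLaw_prod_Iic_compl (hu _) (hu _)
  · intro p _ hp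
    simp [A, hp]
  · intro p _
    have := mul_le_one₀ (hu p.1.1).2 (hu p.1.2).1 (hu p.1.2).2
    linarith

theorem prefLaw_unblocked_inter_blockedAt {n : ℕ} (Q : Finset (UPair n)) {u : Fin n → ℝ}
    (hu : ∀ i, u i ∈ Set.Icc (0 : ℝ) 1) {p₀ : UPair n} (hp₀ : p₀ ∉ Q) :
    prefLaw n (unblocked Q u ∩ blockedAt p₀ u) =
      ENNReal.ofReal (u p₀.1.1 * u p₀.1.2 * ∏ p ∈ Q, (1 - u p.1.1 * u p.1.2)) := by
  let A : UPair n → Set (ℝ × ℝ) := fun p =>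
    if p ∈ Q then (Set.Iic (u p.1.1) ×ˢ Set.Iic (u p.1.2))ᶜ
    else if p = p₀ then Set.Iic (u p.1.1) ×ˢ Set.Iic (u p.1.2) else Set.univ
  have hA : unblocked Q u ∩ blockedAt p₀ u = pairEntries ⁻¹' Set.univ.pi A := by
    ext Y
    simp only [unblocked, blockedAt, Set.mem_inter_iff, Set.mem_ofPred_eq, Set.mem_preimage,
      Set.mem_pi, Set.mem_univ, forall_const]
    constructor
    · rintro ⟨h1, h2⟩ p
      by_cases hp : p ∈ Q
      · simpa [A, hp, Prod.le_def] using h1 p hp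
      · by_cases hp' : p = p₀
        · subst hp'
          simpa [A, hp, Prod.le_def] using h2
        · simp [A, hp, hp']
    · intro h
      refine ⟨fun p hp => by simpa [A, hp, Prod.le_def] using h p,
        by simpa [A, hp₀, Prod.le_def] using h p₀⟩
  have hAm : ∀ p, MeasurableSet (A p) := fun p => by
    have := (measurableSet_Iic (a := u p.1.1)).prod (measurableSet_Iic (a := u p.1.2))
    simp only [A]
    split_ifs
    · exact this.compl
    · exact this
    · exact MeasurableSet.univ
  have h1 : ∀ p ∈ Q, 0 ≤ 1 - u p.1.1 * u p.1.2 := fun p _ => by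
    have := mul_le_one₀ (hu p.1.1).2 (hu p.1.2).1 (hu p.1.2).2
    linarith
  rw [hA, (measurePreserving_pairEntries n).measure_preimage
    (MeasurableSet.univ_pi hAm).nullMeasurableSet, Measure.pi_pi,
    ENNReal.ofReal_mul (mul_nonneg (hu _).1 (hu _).1),
    ENNReal.ofReal_prod_of_nonneg h1, ← Finset.prod_subset (Finset.subset_univ (insert p₀ Q)),
    Finset.prod_insert hp₀]
  · congr 1
    · simp only [A, hp₀, if_true, if_false]
      exact unitLaw_prod_Iic (hu _) (hu _)
    · refine Finset.prod_congr rfl fun p hp => ?_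
      simp only [A, hp, if_true]
      exact unitLaw_prod_Iic_compl (hu _) (hu _)
  · intro p _ hp
    simp only [Finset.mem_insert, not_or] at hp
    simp [A, hp]

open Set Real in
theorem lintegral_pow_mul_exp_neg_mul (m : ℕ) {t : ℝ} (ht : 0 < t) :
    ∫⁻ x in Ioi (0 : ℝ), ENNReal.ofReal (x ^ m * exp (-(t * x))) =
      ENNReal.ofReal (m.factorial / t ^ (m + 1)) := by
  have h := integral_rpow_mul_exp_neg_mul_Ioi (a := m + 1) (r := t) (by positivity) ht
  simp only [add_sub_cancel_right, rpow_natCast] at h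
  rw [Real.Gamma_nat_eq_factorial] at h
  have h2 : (1 / t) ^ ((m : ℝ) + 1) * (m.factorial : ℝ) = m.factorial / t ^ (m + 1) := by
    rw [show ((m : ℝ) + 1) = ((m + 1 : ℕ) : ℝ) by push_cast; ring, rpow_natCast, one_div, inv_pow]
    field_simp
  rw [h2] at h
  rw [← h, ofReal_integral_eq_lintegral_ofReal]
  · by_contra hc
    rw [integral_undef hc] at h
    have : (0 : ℝ) < m.factorial / t ^ (m + 1) := by positivity
    linarith
  · refine (ae_restrict_iff' measurableSet_Ioi).2 (Eventually.of_forall fun x hx => ?_)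
    have : (0 : ℝ) < x := hx
    simp only [Pi.zero_apply]
    positivity

open Set Real in
theorem lintegral_unitLaw_pow_mul_exp_le (m : ℕ) {t : ℝ} (ht : 0 < t) :
    ∫⁻ x, ENNReal.ofReal (x ^ m * exp (-(t * x))) ∂unitLaw ≤
      ENNReal.ofReal (m.factorial / t ^ (m + 1)) := by
  rw [← lintegral_pow_mul_exp_neg_mul m ht, unitLaw, Measure.restrict_congr_set Ioc_ae_eq_Icc.symm]
  exact lintegral_mono_set Ioc_subset_Ioi_self

open Set Real in
theorem lintegral_unitLaw_prod_better_le (m : ℕ) {t : ℝ} (ht : 0 < t) :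
    ∫⁻ w, {w : ℝ × ℝ | w.2 ≤ w.1}.indicator
        (fun w => ENNReal.ofReal (w.1 ^ m * exp (-(t * w.1)))) w ∂(unitLaw.prod unitLaw) ≤
      ENNReal.ofReal ((m + 1).factorial / t ^ (m + 2)) := by
  have hms : MeasurableSet {w : ℝ × ℝ | w.2 ≤ w.1} :=
    measurableSet_le measurable_snd measurable_fst
  rw [lintegral_prod _ ((Measurable.indicator (by fun_prop) hms).aemeasurable)]
  refine le_trans ?_ (lintegral_unitLaw_pow_mul_exp_le (m + 1) ht)
  refine lintegral_mono_ae ?_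
  have hae : ∀ᵐ x ∂unitLaw, x ∈ Icc (0 : ℝ) 1 := ae_restrict_mem measurableSet_Icc
  filter_upwards [hae] with x hx
  have : ∀ y : ℝ, {w : ℝ × ℝ | w.2 ≤ w.1}.indicator
      (fun w => ENNReal.ofReal (w.1 ^ m * exp (-(t * w.1)))) (x, y) =
      (Iic x).indicator (fun _ => ENNReal.ofReal (x ^ m * exp (-(t * x)))) y := by
    intro y
    simp [indicator_apply]
  simp only [this]
  rw [lintegral_indicator measurableSet_Iic, setLIntegral_const, unitLaw_Iic hx.2,
    ← ENNReal.ofReal_mul (mul_nonneg (pow_nonneg hx.1 _) (exp_pos _).le)]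
  apply le_of_eq
  congr 1
  ring

open Set Real in
theorem lintegral_unitLaw_prod_worse_le (m : ℕ) {t : ℝ} (ht : 0 < t) :
    ∫⁻ w, {w : ℝ × ℝ | w.1 ≤ w.2}.indicator
        (fun w => ENNReal.ofReal (w.2 ^ m * exp (-(t * w.2)))) w ∂(unitLaw.prod unitLaw) ≤
      ENNReal.ofReal ((m + 1).factorial / t ^ (m + 2)) := by
  refine le_trans (le_of_eq ?_) (lintegral_unitLaw_prod_better_le m ht)
  have hms : MeasurableSet {w : ℝ × ℝ | w.1 ≤ w.2} :=
    measurableSet_le measurable_fst measurable_snd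
  rw [← Measure.prod_swap, lintegral_map (Measurable.indicator (by fun_prop) hms) measurable_swap]
  rw [Measure.prod_swap]
  rfl

/-- The three ways in which a vertex may fare when a matching is replaced by another one. -/
inductive Fate
  /-- the partner stays the same -/
  | same
  /-- the new partner is better -/
  | better
  /-- the new partner is worse -/
  | worse

namespace Fate

/-- The value pairs (old value, new value) that are compatible with a fate. -/
def region : Fate → Set (ℝ × ℝ)
  | same => Set.Ioi 0 ×ˢ Set.Ioo 0 1
  | better => {w | 0 < w.2 ∧ w.2 < w.1}
  | worse => {w | 0 < w.1 ∧ w.1 < w.2}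

/-- The larger value of a value pair, where the second one is disregarded if nothing changes. -/
def top : Fate → ℝ × ℝ → ℝ
  | same => Prod.fst
  | better => Prod.fst
  | worse => Prod.snd

/-- The total mass of `exp (-t * top)` on the region of a fate. -/
noncomputable def mass (t : ℝ) : Fate → ℝ
  | same => 1 / t
  | better => 1 / t ^ 2
  | worse => 1 / t ^ 2

theorem measurableSet_region (k : Fate) : MeasurableSet k.region := by
  cases k
  · exact measurableSet_Ioi.prod measurableSet_Ioo
  · exact (measurableSet_lt measurable_const measurable_snd).inter
      (measurableSet_lt measurable_snd measurable_fst)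
  · exact (measurableSet_lt measurable_const measurable_fst).inter
      (measurableSet_lt measurable_fst measurable_snd)

@[fun_prop]
theorem measurable_top (k : Fate) : Measurable k.top := by
  cases k
  · exact measurable_fst
  · exact measurable_fst
  · exact measurable_snd

theorem mass_pos {t : ℝ} (ht : 0 < t) (k : Fate) : 0 < k.mass t := by
  cases k <;> simp only [mass] <;> positivity

/-- The law of the value pair of a vertex with a given fate when the rate is `t`. -/
noncomputable def law (t : ℝ) (k : Fate) : Measure (ℝ × ℝ) :=
  volume.withDensity (k.region.indicator fun w =>
    ENNReal.ofReal (Real.exp (-(t * k.top w)) / k.mass t))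

/-- The factor by which the moments of the old value exceed those of an exponential variable. -/
def momentFactor (m : ℕ) : Fate → ℕ
  | better => m + 1
  | _ => 1

open Set Real in
theorem lintegral_pow_mul_exp_region (m : ℕ) {t : ℝ} (ht : 0 < t) (k : Fate) :
    ∫⁻ w, k.region.indicator (fun w => ENNReal.ofReal (w.1 ^ m * exp (-(t * k.top w)))) w =
      ENNReal.ofReal (k.mass t * (k.momentFactor m * m.factorial / t ^ m)) := by
  have hmeas : Measurable (k.region.indicator
      (fun w => ENNReal.ofReal (w.1 ^ m * exp (-(t * k.top w))))) :=
    Measurable.indicator (by fun_prop) k.measurableSet_region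
  rw [Measure.volume_eq_prod]
  cases k with
  | same =>
    rw [lintegral_prod _ hmeas.aemeasurable]
    have : ∀ x y : ℝ, (region same).indicator
        (fun w => ENNReal.ofReal (w.1 ^ m * exp (-(t * same.top w)))) (x, y) =
        (Ioi 0).indicator (fun x => ENNReal.ofReal (x ^ m * exp (-(t * x)))) x *
          (Ioo 0 1).indicator (fun _ => 1) y := by
      intro x y
      by_cases h1 : 0 < x <;> by_cases h2 : y ∈ Ioo (0 : ℝ) 1 <;>
        simp [indicator, region, top, h1, h2, -mem_Ioo]
    simp only [this]
    have hv : ∫⁻ y : ℝ, (Ioo (0 : ℝ) 1).indicator (fun _ => (1 : ENNReal)) y = 1 := by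
      rw [lintegral_indicator measurableSet_Ioo]; simp
    have : ∀ x : ℝ, ∫⁻ y : ℝ, (Ioi 0).indicator
        (fun x => ENNReal.ofReal (x ^ m * exp (-(t * x)))) x *
          (Ioo (0 : ℝ) 1).indicator (fun _ => 1) y = (Ioi 0).indicator
        (fun x => ENNReal.ofReal (x ^ m * exp (-(t * x)))) x := by
      intro x
      rw [lintegral_const_mul _ (Measurable.indicator (by fun_prop) measurableSet_Ioo), hv, mul_one]
    simp only [this]
    rw [lintegral_indicator measurableSet_Ioi, lintegral_pow_mul_exp_neg_mul m ht]
    congr 1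
    simp only [mass, momentFactor]
    push_cast
    field_simp
    ring
  | better =>
    rw [lintegral_prod _ hmeas.aemeasurable]
    have : ∀ x y : ℝ, (region better).indicator
        (fun w => ENNReal.ofReal (w.1 ^ m * exp (-(t * better.top w)))) (x, y) =
        (Ioo 0 x).indicator (fun _ => ENNReal.ofReal (x ^ m * exp (-(t * x)))) y := by
      intro x y
      by_cases hy : 0 < y ∧ y < x
      · simp [indicator, region, top, hy]
      · simp [indicator, region, hy]
    simp only [this]
    have : ∀ x : ℝ, ∫⁻ y : ℝ, (Ioo 0 x).indicator
        (fun _ => ENNReal.ofReal (x ^ m * exp (-(t * x)))) y =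
        (Ioi 0).indicator (fun x => ENNReal.ofReal (x ^ (m + 1) * exp (-(t * x)))) x := by
      intro x
      rw [lintegral_indicator measurableSet_Ioo, setLIntegral_const, Real.volume_Ioo]
      by_cases hx : 0 < x
      · rw [indicator_of_mem (mem_Ioi.2 hx), ← ENNReal.ofReal_mul (by positivity)]
        congr 1
        ring
      · rw [indicator_of_notMem (by simpa using hx), ENNReal.ofReal_of_nonpos (p := x - 0)
          (by linarith), mul_zero]
    simp only [this]
    rw [lintegral_indicator measurableSet_Ioi, lintegral_pow_mul_exp_neg_mul (m + 1) ht]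
    congr 1
    simp only [mass, momentFactor, Nat.factorial_succ]
    push_cast
    field_simp
    ring
  | worse =>
    rw [lintegral_prod_symm _ hmeas.aemeasurable]
    have : ∀ y x : ℝ, (region worse).indicator
        (fun w => ENNReal.ofReal (w.1 ^ m * exp (-(t * worse.top w)))) (x, y) =
        (Ioo 0 y).indicator (fun x => ENNReal.ofReal (exp (-(t * y))) * ENNReal.ofReal (x ^ m)) x := by
      intro y x
      by_cases hx : 0 < x ∧ x < y
      · simp only [indicator, region, top, mem_ofPred_eq, hx, and_self, if_true, mem_Ioo]
        rw [← ENNReal.ofReal_mul (exp_pos _).le, mul_comm]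
      · simp [indicator, region, hx]
    simp only [this]
    have : ∀ y : ℝ, ∫⁻ x : ℝ, (Ioo 0 y).indicator (fun x => ENNReal.ofReal (exp (-(t * y))) *
          ENNReal.ofReal (x ^ m)) x =
        (Ioi 0).indicator (fun x => ENNReal.ofReal (1 / (m + 1)) *
          ENNReal.ofReal (x ^ (m + 1) * exp (-(t * x)))) y := by
      intro y
      rw [lintegral_indicator measurableSet_Ioo, lintegral_const_mul _ (by fun_prop)]
      by_cases hy : 0 < y
      · rw [indicator_of_mem (mem_Ioi.2 hy), Measure.restrict_congr_set Ioo_ae_eq_Ioc,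
          ← ofReal_integral_eq_lintegral_ofReal, ← intervalIntegral.integral_of_le hy.le,
          integral_pow, ← ENNReal.ofReal_mul (exp_pos _).le, ← ENNReal.ofReal_mul (by positivity)]
        · congr 1
          simp only [ne_eq, Nat.add_eq_zero_iff, one_ne_zero, and_false, not_false_eq_true,
            zero_pow, sub_zero]
          ring
        · exact (continuous_pow m).integrableOn_Ioc
        · refine (ae_restrict_iff' measurableSet_Ioc).2 (Eventually.of_forall fun x hx => ?_)
          exact pow_nonneg hx.1.le _
      · rw [indicator_of_notMem (by simpa using hy), Ioo_eq_empty hy]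
        simp
    simp only [this]
    rw [lintegral_indicator measurableSet_Ioi, lintegral_const_mul _ (by fun_prop),
      lintegral_pow_mul_exp_neg_mul (m + 1) ht, ← ENNReal.ofReal_mul (by positivity)]
    congr 1
    simp only [mass, momentFactor, Nat.factorial_succ]
    push_cast
    field_simp
    ring

open Set Real in
theorem lintegral_pow_law (m : ℕ) {t : ℝ} (ht : 0 < t) (k : Fate) :
    ∫⁻ w, ENNReal.ofReal (w.1 ^ m) ∂(k.law t) =
      ENNReal.ofReal (k.momentFactor m * m.factorial / t ^ m) := by
  have hk := k.mass_pos ht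
  rw [law, lintegral_withDensity_eq_lintegral_mul _
    (Measurable.indicator (by fun_prop) k.measurableSet_region) (by fun_prop)]
  have : ∀ w : ℝ × ℝ, ((k.region.indicator fun w =>
      ENNReal.ofReal (Real.exp (-(t * k.top w)) / k.mass t)) *
      fun w : ℝ × ℝ => ENNReal.ofReal (w.1 ^ m)) w = ENNReal.ofReal (1 / k.mass t) *
      k.region.indicator (fun w => ENNReal.ofReal (w.1 ^ m * exp (-(t * k.top w)))) w := by
    intro w
    by_cases hw : w ∈ k.region
    · simp only [Pi.mul_apply, indicator_of_mem hw]
      rw [← ENNReal.ofReal_mul (by positivity), ← ENNReal.ofReal_mul (by positivity)]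
      congr 1
      ring
    · simp [indicator_of_notMem hw]
  simp only [this]
  rw [lintegral_const_mul _ (Measurable.indicator (by fun_prop) k.measurableSet_region),
    lintegral_pow_mul_exp_region m ht, ← ENNReal.ofReal_mul (by positivity)]
  congr 1
  field_simp

theorem isProbabilityMeasure_law {t : ℝ} (ht : 0 < t) (k : Fate) :
    IsProbabilityMeasure (k.law t) := by
  refine ⟨?_⟩
  have h := lintegral_pow_law 0 ht k
  have h1 : k.momentFactor 0 = 1 := by cases k <;> rfl
  simpa [h1] using h

theorem ae_mem_region {t : ℝ} (k : Fate) : ∀ᵐ w ∂(k.law t), w ∈ k.region := by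
  rw [law, ae_withDensity_iff (Measurable.indicator (by fun_prop) k.measurableSet_region)]
  refine Eventually.of_forall fun w hw => ?_
  by_contra hc
  exact hw (Set.indicator_of_notMem hc _)

theorem fst_pos_of_mem_region {k : Fate} {w : ℝ × ℝ} (hw : w ∈ k.region) : 0 < w.1 := by
  cases k
  · exact hw.1
  · exact hw.1.trans hw.2
  · exact hw.1

theorem ae_fst_nonneg {t : ℝ} (k : Fate) : ∀ᵐ w ∂(k.law t), 0 ≤ w.1 := by
  filter_upwards [k.ae_mem_region (t := t)] with w hw using (fst_pos_of_mem_region hw).le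

theorem integrable_pow_law (m : ℕ) {t : ℝ} (ht : 0 < t) (k : Fate) :
    Integrable (fun w : ℝ × ℝ => w.1 ^ m) (k.law t) := by
  refine ⟨by fun_prop, ?_⟩
  rw [hasFiniteIntegral_iff_ofReal, lintegral_pow_law m ht]
  · exact ENNReal.ofReal_lt_top
  · filter_upwards [k.ae_fst_nonneg (t := t)] with w hw using pow_nonneg hw m

theorem integral_pow_law (m : ℕ) {t : ℝ} (ht : 0 < t) (k : Fate) :
    ∫ w, w.1 ^ m ∂(k.law t) = k.momentFactor m * m.factorial / t ^ m := by
  rw [integral_eq_lintegral_of_nonneg_ae, lintegral_pow_law m ht,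
    ENNReal.toReal_ofReal (by positivity)]
  · filter_upwards [k.ae_fst_nonneg (t := t)] with w hw using pow_nonneg hw m
  · fun_prop

theorem memLp_pow_law (m : ℕ) {t : ℝ} (ht : 0 < t) (k : Fate) :
    MemLp (fun w : ℝ × ℝ => w.1 ^ m) 2 (k.law t) := by
  rw [memLp_two_iff_integrable_sq (by fun_prop)]
  simpa only [← pow_mul] using integrable_pow_law (m * 2) ht k

open Set Real in
theorem law_top_gt_le {t : ℝ} (ht : 0 < t) (k : Fate) (L : ℝ) :
    (k.law t) {w | L < k.top w} ≤ ENNReal.ofReal (4 * exp (-(t * L / 2))) := by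
  have hs : MeasurableSet {w | L < k.top w} := measurableSet_lt measurable_const k.measurable_top
  have hk := k.mass_pos ht
  rw [law, withDensity_apply _ hs]
  have h0 := lintegral_pow_mul_exp_region 0 (half_pos ht) k
  have hle : ∀ w ∈ {w | L < k.top w}, k.region.indicator (fun w =>
      ENNReal.ofReal (Real.exp (-(t * k.top w)) / k.mass t)) w ≤
      ENNReal.ofReal (exp (-(t * L / 2)) / k.mass t) * k.region.indicator
        (fun w => ENNReal.ofReal (w.1 ^ 0 * exp (-(t / 2 * k.top w)))) w := by
    intro w hw
    by_cases hr : w ∈ k.region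
    · simp only [indicator_of_mem hr]
      rw [← ENNReal.ofReal_mul (by positivity)]
      apply ENNReal.ofReal_le_ofReal
      rw [pow_zero, one_mul, div_mul_eq_mul_div, ← exp_add]
      have hw' : L < k.top w := hw
      gcongr
      nlinarith
    · simp [indicator_of_notMem hr]
  refine (setLIntegral_mono' hs hle).trans ?_
  refine (setLIntegral_le_lintegral _ _).trans ?_
  rw [lintegral_const_mul _ (Measurable.indicator (by fun_prop) k.measurableSet_region), h0,
    ← ENNReal.ofReal_mul (by positivity)]
  apply ENNReal.ofReal_le_ofReal
  have h1 : k.momentFactor 0 = 1 := by cases k <;> rfl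
  have h2 : k.mass (t / 2) ≤ 4 * k.mass t := by
    cases k
    · simp only [mass]; field_simp; norm_num
    · simp only [mass]; field_simp; norm_num
    · simp only [mass]; field_simp; norm_num
  simp only [h1, Nat.cast_one, Nat.factorial_zero, pow_zero, mul_one, div_one]
  rw [div_mul_eq_mul_div, div_le_iff₀ hk]
  nlinarith [exp_pos (-(t * L / 2))]

open Set Real in
/-- On the unit square the law of a value pair has the given density with respect to the uniform
law. -/
theorem law_restrict_unit (t : ℝ) (k : Fate) :
    (k.law t).restrict (Icc 0 1 ×ˢ Icc 0 1) =
      (unitLaw.prod unitLaw).withDensity (k.region.indicator fun w =>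
        ENNReal.ofReal (exp (-(t * k.top w)) / k.mass t)) := by
  rw [law, restrict_withDensity (measurableSet_Icc.prod measurableSet_Icc),
    unitLaw_prod_eq_restrict]

end Fate

theorem pi_withDensity_of_prob {ι : Type*} [Fintype ι] {Ω : ι → Type*}
    [∀ i, MeasurableSpace (Ω i)] (μ : ∀ i, Measure (Ω i)) [∀ i, IsProbabilityMeasure (μ i)]
    (f : ∀ i, Ω i → ENNReal) (hf : ∀ i, Measurable (f i))
    [∀ i, SigmaFinite ((μ i).withDensity (f i))] :
    Measure.pi (fun i => (μ i).withDensity (f i)) =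
      (Measure.pi μ).withDensity fun w => ∏ i, f i (w i) := by
  refine Measure.pi_eq fun s hs => ?_
  rw [withDensity_apply _ (MeasurableSet.univ_pi hs), ← lintegral_indicator (MeasurableSet.univ_pi hs)]
  have : ∀ w, (Set.univ.pi s).indicator (fun w => ∏ i, f i (w i)) w =
      ∏ i, (s i).indicator (f i) (w i) := by
    intro w
    by_cases hw : w ∈ Set.univ.pi s
    · rw [Set.indicator_of_mem hw]
      exact Finset.prod_congr rfl fun i _ => (Set.indicator_of_mem (hw i trivial) _).symm
    · rw [Set.indicator_of_notMem hw]
      simp only [Set.mem_pi, Set.mem_univ, forall_const, not_forall] at hw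
      obtain ⟨i, hi⟩ := hw
      exact (Finset.prod_eq_zero (Finset.mem_univ i) (Set.indicator_of_notMem hi _)).symm
  simp only [this]
  rw [lintegral_pi_prod μ _ fun i => (hf i).indicator (hs i)]
  refine Finset.prod_congr rfl fun i _ => ?_
  rw [lintegral_indicator (hs i), withDensity_apply _ (hs i)]

open Set Real in
/-- The product of the laws of the value pairs, on sets of arrays with values in `[0, 1]`. -/
theorem pi_law_apply_eq_lintegral {n : ℕ} {t : ℝ} (ht : 0 < t) (k : Fin n → Fate)
    {A : Set (Fin n → ℝ × ℝ)} (hA : MeasurableSet A)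
    (hA1 : ∀ w ∈ A, ∀ i, w i ∈ Icc (0 : ℝ) 1 ×ˢ Icc (0 : ℝ) 1)
    (hA2 : ∀ w ∈ A, ∀ i, w i ∈ (k i).region) :
    Measure.pi (fun i => (k i).law t) A =
      ∫⁻ w in A, ENNReal.ofReal (∏ i, exp (-(t * (k i).top (w i))) / (k i).mass t) ∂(pairLaw n) := by
  have hp := fun i => (k i).isProbabilityMeasure_law ht
  have h1 : Measure.pi (fun i => (k i).law t) A =
      (Measure.pi (fun i => (k i).law t)).restrict
        (univ.pi fun _ => Icc (0 : ℝ) 1 ×ˢ Icc (0 : ℝ) 1) A := by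
    rw [Measure.restrict_apply hA]
    congr 1
    symm
    rw [inter_eq_left]
    intro w hw i _
    exact hA1 w hw i
  have hfin : ∀ i, SigmaFinite ((unitLaw.prod unitLaw).withDensity ((k i).region.indicator fun w =>
        ENNReal.ofReal (exp (-(t * (k i).top w)) / (k i).mass t))) := fun i => by
    rw [← Fate.law_restrict_unit]
    infer_instance
  rw [h1, Measure.restrict_pi_pi]
  simp only [Fate.law_restrict_unit]
  rw [pi_withDensity_of_prob _ _ fun i =>
    Measurable.indicator (by fun_prop) (k i).measurableSet_region, withDensity_apply _ hA]
  refine setLIntegral_congr_fun hA fun w hw => ?_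
  rw [ENNReal.ofReal_prod_of_nonneg fun i _ => by have := (k i).mass_pos ht; positivity]
  exact Finset.prod_congr rfl fun i _ => indicator_of_mem (hA2 w hw i) _

theorem PerfectMatching.two_mul_sum_lt_partner {n : ℕ} (M : PerfectMatching n) (f : Fin n → ℝ)
    (hf : ∀ i, f (M.partner i) = f i) :
    2 * ∑ i with i < M.partner i, f i = ∑ i, f i := by
  rw [← Finset.sum_filter_add_sum_filter_not Finset.univ (fun i => i < M.partner i) f, two_mul]
  congr 1
  refine Finset.sum_bij (fun i _ => M.partner i) ?_ ?_ ?_ ?_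
  · intro i hi
    simp only [Finset.mem_filter, Finset.mem_univ, true_and, M.partner_partner, not_lt] at hi ⊢
    exact hi.le
  · intro i _ j _ h
    rw [← M.partner_partner i, h, M.partner_partner]
  · intro j hj
    simp only [Finset.mem_filter, Finset.mem_univ, true_and, not_lt] at hj
    refine ⟨M.partner j, ?_, M.partner_partner j⟩
    simp only [Finset.mem_filter, Finset.mem_univ, true_and, M.partner_partner]
    exact lt_of_le_of_ne hj (M.ne_partner j).symm
  · intro i _
    exact (hf i).symm

theorem measure_lt_abs_sub_le {Ω : Type*} [MeasurableSpace Ω] {μ : Measure Ω}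
    [IsProbabilityMeasure μ] {X : Ω → ℝ} (hX : MemLp X 2 μ) {m d s r : ℝ}
    (hm : |μ[X] - m| ≤ d) (hs : Var[X; μ] ≤ s) (hr : d < r) :
    μ {w | r < |X w - m|} ≤ ENNReal.ofReal (s / (r - d) ^ 2) := by
  have hc : 0 < r - d := sub_pos.2 hr
  refine (measure_mono fun w hw => ?_).trans
    ((meas_ge_le_variance_div_sq hX hc).trans (ENNReal.ofReal_le_ofReal ?_))
  · have hw' : r < |X w - m| := hw
    have := abs_sub_le (X w) (μ[X]) m
    simp only [Set.mem_ofPred_eq]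
    linarith
  · gcongr

namespace Fate

theorem momentFactor_le (m : ℕ) (k : Fate) : (k.momentFactor m : ℝ) ≤ m + 1 := by
  cases k <;> simp [momentFactor]

theorem one_le_momentFactor (m : ℕ) (k : Fate) : (1 : ℝ) ≤ k.momentFactor m := by
  cases k <;> simp [momentFactor]

open Classical in
theorem momentFactor_sub_one_le (m : ℕ) (k : Fate) :
    (k.momentFactor m : ℝ) - 1 ≤ m * (if k = same then 0 else 1) := by
  cases k <;> simp [momentFactor]

variable {n : ℕ} {t : ℝ}

theorem integral_sum_pow_law (m : ℕ) (ht : 0 < t) (k : Fin n → Fate) :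
    ∫ w, (∑ i, (w i).1 ^ m) ∂(Measure.pi fun i => (k i).law t) =
      ∑ i, (k i).momentFactor m * m.factorial / t ^ m := by
  have hp := fun i => (k i).isProbabilityMeasure_law ht
  rw [integral_finsetSum _ fun i _ => integrable_comp_eval (μ := fun i => (k i).law t) (i := i)
    (integrable_pow_law m ht (k i))]
  refine Finset.sum_congr rfl fun i _ => ?_
  rw [← integral_pow_law m ht (k i)]
  exact integral_comp_eval (μ := fun i => (k i).law t) (i := i)
    (f := fun w : ℝ × ℝ => w.1 ^ m) (by fun_prop)

theorem memLp_sum_pow_law (m : ℕ) (ht : 0 < t) (k : Fin n → Fate) :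
    MemLp (fun w : Fin n → ℝ × ℝ => ∑ i, (w i).1 ^ m) 2 (Measure.pi fun i => (k i).law t) := by
  have hp := fun i => (k i).isProbabilityMeasure_law ht
  refine memLp_finsetSum _ fun i _ => ?_
  exact (memLp_pow_law m ht (k i)).comp_measurePreserving (measurePreserving_eval _ i)

theorem variance_sum_pow_law_le (m : ℕ) (ht : 0 < t) (k : Fin n → Fate) :
    Var[fun w : Fin n → ℝ × ℝ => ∑ i, (w i).1 ^ m; Measure.pi fun i => (k i).law t] ≤
      n * ((2 * m + 1) * (2 * m).factorial / t ^ (2 * m)) := by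
  have hp := fun i => (k i).isProbabilityMeasure_law ht
  have h := variance_sum_pi (μ := fun i => (k i).law t)
    (X := fun i (w : ℝ × ℝ) => w.1 ^ m) fun i => memLp_pow_law m ht (k i)
  have he : (∑ i, fun w : Fin n → ℝ × ℝ => (w i).1 ^ m) = fun w => ∑ i, (w i).1 ^ m := by
    ext w; simp
  rw [he] at h
  rw [h]
  have hb : ∀ i, Var[fun w : ℝ × ℝ => w.1 ^ m; (k i).law t] ≤
      (2 * m + 1) * (2 * m).factorial / t ^ (2 * m) := by
    intro i
    refine (variance_le_expectation_sq (by fun_prop)).trans ?_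
    have : ∀ w : ℝ × ℝ, ((fun w : ℝ × ℝ => w.1 ^ m) ^ 2) w = w.1 ^ (2 * m) := by
      intro w; simp [← pow_mul, mul_comm]
    simp only [this, integral_pow_law (2 * m) ht]
    have := momentFactor_le (2 * m) (k i)
    push_cast at this
    gcongr
  refine (Finset.sum_le_sum fun i _ => hb i).trans ?_
  simp

/-- The old values as random variables are independent. -/
theorem iIndepFun_fst (ht : 0 < t) (k : Fin n → Fate) :
    iIndepFun (fun (i : Fin n) (w : Fin n → ℝ × ℝ) => (w i).1)
      (Measure.pi fun i => (k i).law t) := by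
  have hp := fun i => (k i).isProbabilityMeasure_law ht
  exact iIndepFun_pi (μ := fun i => (k i).law t) (X := fun i (w : ℝ × ℝ) => w.1)
    fun i => measurable_fst.aemeasurable

theorem integral_mul_pow_law (m : ℕ) (ht : 0 < t) (k : Fin n → Fate) {i j : Fin n}
    (hij : i ≠ j) :
    ∫ w, ((w i).1 ^ m * (w j).1 ^ m) ∂(Measure.pi fun i => (k i).law t) =
      (k i).momentFactor m * m.factorial / t ^ m * ((k j).momentFactor m * m.factorial / t ^ m) := by
  have hp := fun i => (k i).isProbabilityMeasure_law ht
  have hI := ((iIndepFun_fst ht k).indepFun hij).comp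
    (measurable_id.pow_const m) (measurable_id.pow_const m)
  rw [← integral_pow_law m ht (k i), ← integral_pow_law m ht (k j)]
  rw [← integral_comp_eval (μ := fun i => (k i).law t) (i := i)
    (f := fun w : ℝ × ℝ => w.1 ^ m) (by fun_prop),
    ← integral_comp_eval (μ := fun i => (k i).law t) (i := j)
    (f := fun w : ℝ × ℝ => w.1 ^ m) (by fun_prop)]
  exact hI.integral_mul_eq_mul_integral
    (((measurable_pi_apply i).fst.pow_const m).aestronglyMeasurable)
    (((measurable_pi_apply j).fst.pow_const m).aestronglyMeasurable)

theorem memLp_mul_law (ht : 0 < t) (k : Fin n → Fate) {i j : Fin n} (hij : i ≠ j) :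
    MemLp (fun w : Fin n → ℝ × ℝ => (w i).1 * (w j).1) 2 (Measure.pi fun i => (k i).law t) := by
  have hp := fun i => (k i).isProbabilityMeasure_law ht
  rw [memLp_two_iff_integrable_sq (by fun_prop)]
  have hI := ((iIndepFun_fst ht k).indepFun hij).comp
    (measurable_id.pow_const 2) (measurable_id.pow_const 2)
  have := hI.integrable_mul
    (integrable_comp_eval (μ := fun i => (k i).law t) (i := i) (integrable_pow_law 2 ht (k i)))
    (integrable_comp_eval (μ := fun i => (k i).law t) (i := j) (integrable_pow_law 2 ht (k j)))
  simp only [mul_pow]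
  exact this

theorem variance_mul_law_le (ht : 0 < t) (k : Fin n → Fate) {i j : Fin n} (hij : i ≠ j) :
    Var[fun w : Fin n → ℝ × ℝ => (w i).1 * (w j).1; Measure.pi fun i => (k i).law t] ≤
      36 / t ^ 4 := by
  have hp := fun i => (k i).isProbabilityMeasure_law ht
  refine (variance_le_expectation_sq (by fun_prop)).trans ?_
  have : ∀ w : Fin n → ℝ × ℝ, ((fun w : Fin n → ℝ × ℝ => (w i).1 * (w j).1) ^ 2) w =
      (w i).1 ^ 2 * (w j).1 ^ 2 := by
    intro w; simp [mul_pow]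
  simp only [this, integral_mul_pow_law 2 ht k hij]
  have h1 := momentFactor_le 2 (k i)
  have h2 := momentFactor_le 2 (k j)
  push_cast at h1 h2
  rw [div_mul_div_comm, ← pow_add]
  simp only [Nat.factorial, Nat.succ_eq_add_one]
  push_cast
  gcongr
  nlinarith [one_le_momentFactor 2 (k i), one_le_momentFactor 2 (k j)]

/-- The number of vertices whose partner changes. -/
noncomputable def changes (k : Fin n → Fate) : ℕ := by
  classical exact (Finset.univ.filter fun i => k i ≠ same).card

theorem sum_momentFactor_sub_one (m : ℕ) (k : Fin n → Fate) :
    ∑ i, ((k i).momentFactor m - 1 : ℝ) ≤ m * changes k := by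
  classical
  refine (Finset.sum_le_sum fun i _ => momentFactor_sub_one_le m (k i)).trans ?_
  rw [← Finset.mul_sum, changes, Finset.card_filter]
  push_cast
  simp only [ne_eq, ite_not]
  exact le_of_eq (by congr)

theorem abs_integral_sum_pow_law_sub_le (m : ℕ) (ht : 0 < t) (k : Fin n → Fate) :
    |∫ w, (∑ i, (w i).1 ^ m) ∂(Measure.pi fun i => (k i).law t) - n * (m.factorial / t ^ m)| ≤
      m * changes k * (m.factorial / t ^ m) := by
  rw [integral_sum_pow_law m ht]
  have : ∑ i, (k i).momentFactor m * m.factorial / t ^ m - n * (m.factorial / t ^ m) =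
      (∑ i, ((k i).momentFactor m - 1 : ℝ)) * (m.factorial / t ^ m) := by
    rw [Finset.sum_mul]
    simp only [sub_mul, Finset.sum_sub_distrib]
    simp [mul_div_assoc]
  rw [this, abs_of_nonneg]
  · have := sum_momentFactor_sub_one m k
    gcongr
  · refine mul_nonneg (Finset.sum_nonneg fun i _ => ?_) (by positivity)
    linarith [one_le_momentFactor m (k i)]

theorem abs_integral_sum_partner_sub_le (ht : 0 < t) (k : Fin n → Fate) (M : PerfectMatching n) :
    |∫ w, (∑ i with i < M.partner i, (w i).1 * (w (M.partner i)).1)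
      ∂(Measure.pi fun i => (k i).law t) - n / 2 * (1 / t ^ 2)| ≤ 2 * changes k * (1 / t ^ 2) := by
  have hp := fun i => (k i).isProbabilityMeasure_law ht
  rw [integral_finsetSum _ fun i _ =>
    (memLp_mul_law ht k (M.ne_partner i)).integrable (by norm_num)]
  have h1 : ∀ i, ∫ w, ((w i).1 * (w (M.partner i)).1) ∂(Measure.pi fun i => (k i).law t) =
      ((k i).momentFactor 1 * (k (M.partner i)).momentFactor 1) * (1 / t ^ 2) := by
    intro i
    have := integral_mul_pow_law 1 ht k (M.ne_partner i)
    simp only [pow_one, Nat.factorial_one, Nat.cast_one, mul_one] at this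
    rw [this]
    field_simp
  simp only [h1]
  rw [← Finset.sum_mul, ← sub_mul, abs_mul, abs_of_nonneg (a := 1 / t ^ 2) (by positivity)]
  refine mul_le_mul_of_nonneg_right ?_ (by positivity)
  have h2 := M.two_mul_sum_lt_partner
    (fun i => ((k i).momentFactor 1 : ℝ) * (k (M.partner i)).momentFactor 1) (fun i => by
      rw [M.partner_partner, mul_comm])
  have h3 : ∑ i, (((k i).momentFactor 1 : ℝ) * (k (M.partner i)).momentFactor 1 - 1) =
      ∑ i, ((k i).momentFactor 1 : ℝ) * (k (M.partner i)).momentFactor 1 - n := by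
    simp [Finset.sum_sub_distrib]
  have hperm : ∑ i, ((k (M.partner i)).momentFactor 1 - 1 : ℝ) =
      ∑ i, ((k i).momentFactor 1 - 1 : ℝ) :=
    Equiv.sum_comp (Function.Involutive.toPerm M.partner M.partner_partner)
      (fun i => ((k i).momentFactor 1 - 1 : ℝ))
  have h4 : ∑ i, (((k i).momentFactor 1 : ℝ) * (k (M.partner i)).momentFactor 1 - 1) ≤
      ∑ i, (2 * ((k i).momentFactor 1 - 1 : ℝ) + 2 * ((k (M.partner i)).momentFactor 1 - 1)) := by
    refine Finset.sum_le_sum fun i _ => ?_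
    have a1 := momentFactor_le 1 (k i)
    have a2 := momentFactor_le 1 (k (M.partner i))
    have b1 := one_le_momentFactor 1 (k i)
    have b2 := one_le_momentFactor 1 (k (M.partner i))
    push_cast at a1 a2
    nlinarith
  rw [Finset.sum_add_distrib, ← Finset.mul_sum, ← Finset.mul_sum, hperm] at h4
  have h5 := sum_momentFactor_sub_one 1 k
  have h6 : 0 ≤ ∑ i, (((k i).momentFactor 1 : ℝ) * (k (M.partner i)).momentFactor 1 - 1) := by
    refine Finset.sum_nonneg fun i _ => ?_
    have b1 := one_le_momentFactor 1 (k i)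
    have b2 := one_le_momentFactor 1 (k (M.partner i))
    nlinarith
  push_cast at h5
  rw [abs_of_nonneg] <;> linarith

theorem memLp_sum_partner (ht : 0 < t) (k : Fin n → Fate) (M : PerfectMatching n) :
    MemLp (fun w : Fin n → ℝ × ℝ => ∑ i with i < M.partner i, (w i).1 * (w (M.partner i)).1) 2
      (Measure.pi fun i => (k i).law t) :=
  memLp_finsetSum _ fun i _ => memLp_mul_law ht k (M.ne_partner i)

theorem variance_sum_partner_le (ht : 0 < t) (k : Fin n → Fate) (M : PerfectMatching n) :
    Var[fun w : Fin n → ℝ × ℝ => ∑ i with i < M.partner i, (w i).1 * (w (M.partner i)).1;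
      Measure.pi fun i => (k i).law t] ≤ n * (36 / t ^ 4) := by
  have hp := fun i => (k i).isProbabilityMeasure_law ht
  have he : (fun w : Fin n → ℝ × ℝ => ∑ i with i < M.partner i, (w i).1 * (w (M.partner i)).1) =
      ∑ i with i < M.partner i, fun w : Fin n → ℝ × ℝ => (w i).1 * (w (M.partner i)).1 := by
    ext w; simp
  rw [he, IndepFun.variance_sum]
  · refine (Finset.sum_le_sum fun i _ => variance_mul_law_le ht k (M.ne_partner i)).trans ?_
    rw [Finset.sum_const, nsmul_eq_mul]
    gcongr
    exact (Finset.card_le_univ _).trans (by simp)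
  · exact fun i _ => memLp_mul_law ht k (M.ne_partner i)
  · intro i hi j hj hij
    simp only [Finset.coe_filter, Finset.mem_univ, true_and, Set.mem_ofPred_eq] at hi hj
    have e := M.partner_partner
    refine (iIndepFun_fst ht k).indepFun_mul_mul (fun i => by fun_prop) i (M.partner i) j
      (M.partner j) hij ?_ ?_ ?_
    · rintro rfl
      rw [e] at hi
      exact lt_asymm hi hj
    · rintro rfl
      rw [e] at hj
      exact lt_asymm hi hj
    · intro h
      exact hij (by rw [← e i, h, e])

end Fate

/-- The old values and the larger values of the value pairs `w` are close to their typical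
behaviour at rate `t`. -/
def typicalPairs {n : ℕ} (M : PerfectMatching n) (k : Fin n → Fate) (t τ L : ℝ) :
    Set (Fin n → ℝ × ℝ) :=
  {w | |(∑ i, (w i).1) - t| ≤ 10 ∧ (∀ i, (k i).top (w i) ≤ L) ∧
    |(∑ i with i < M.partner i, (w i).1 * (w (M.partner i)).1) - 1 / 2| ≤ τ ∧
    |(∑ i, (w i).1 ^ 2) - 2| ≤ τ}

theorem measurableSet_typicalPairs {n : ℕ} (M : PerfectMatching n) (k : Fin n → Fate)
    (t τ L : ℝ) : MeasurableSet (typicalPairs M k t τ L) := by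
  have h1 : MeasurableSet {w : Fin n → ℝ × ℝ | |(∑ i, (w i).1) - t| ≤ 10} :=
    measurableSet_le (by fun_prop) measurable_const
  have h2 : MeasurableSet {w : Fin n → ℝ × ℝ | ∀ i, (k i).top (w i) ≤ L} := by
    rw [Set.ofPred_forall]
    exact MeasurableSet.iInter fun i => measurableSet_le (by fun_prop) measurable_const
  have h3 : MeasurableSet {w : Fin n → ℝ × ℝ |
      |(∑ i with i < M.partner i, (w i).1 * (w (M.partner i)).1) - 1 / 2| ≤ τ} :=
    measurableSet_le (by fun_prop) measurable_const
  have h4 : MeasurableSet {w : Fin n → ℝ × ℝ | |(∑ i, (w i).1 ^ 2) - 2| ≤ τ} :=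
    measurableSet_le (by fun_prop) measurable_const
  exact h1.inter (h2.inter (h3.inter h4))

theorem half_le_pi_law_typicalPairs {n : ℕ} {t τ L : ℝ} (ht : 0 < t) (htn : t ^ 2 = n)
    (hτ : 0 < τ)
    (M : PerfectMatching n) (k : Fin n → Fate) (h1 : (Fate.changes k : ℝ) ≤ t)
    (h2 : 8 * Fate.changes k ≤ τ * n) (h3 : 3840 ≤ τ ^ 2 * n)
    (h4 : 32 * (n * Real.exp (-(t * L / 2))) ≤ 1) :
    ENNReal.ofReal (1 / 2) ≤ Measure.pi (fun i => (k i).law t) (typicalPairs M k t τ L) := by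
  have hp := fun i => (k i).isProbabilityMeasure_law ht
  set P := Measure.pi (fun i => (k i).law t)
  have hn : (0 : ℝ) < n := by rw [← htn]; positivity
  have t4 : t ^ 4 = n ^ 2 := by rw [← htn]; ring
  have e1 : P {w | 10 < |(∑ i, (w i).1) - t|} ≤ ENNReal.ofReal (1 / 8) := by
    have hm := Fate.abs_integral_sum_pow_law_sub_le 1 ht k
    have hv := Fate.variance_sum_pow_law_le 1 ht k
    have hL := Fate.memLp_sum_pow_law 1 ht k
    simp only [pow_one, Nat.factorial_one, Nat.cast_one, one_mul, mul_one] at hm hv hL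
    have c1 : (n : ℝ) * (1 / t) = t := by rw [← htn]; field_simp
    rw [c1] at hm
    have c2 : (Fate.changes k : ℝ) * (1 / t) ≤ 1 := by
      rw [mul_one_div, div_le_one ht]; exact h1
    refine (measure_lt_abs_sub_le hL (hm.trans c2) hv (by norm_num)).trans
      (ENNReal.ofReal_le_ofReal ?_)
    rw [htn]
    simp only [Nat.factorial, Nat.succ_eq_add_one]
    push_cast
    field_simp
    norm_num
  have e2 : P {w | τ < |(∑ i, (w i).1 ^ 2) - 2|} ≤ ENNReal.ofReal (1 / 8) := by
    have hm := Fate.abs_integral_sum_pow_law_sub_le 2 ht k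
    have hv := Fate.variance_sum_pow_law_le 2 ht k
    have hL := Fate.memLp_sum_pow_law 2 ht k
    rw [htn] at hm
    have c1 : (n : ℝ) * ((2 : ℕ).factorial / n) = 2 := by
      simp only [Nat.factorial]; push_cast; field_simp
    rw [c1] at hm
    have c2 : ((2 : ℕ) : ℝ) * (Fate.changes k : ℝ) * ((2 : ℕ).factorial / n) ≤ τ / 2 := by
      rw [Nat.factorial_two]; push_cast
      rw [show (2 : ℝ) * (Fate.changes k : ℝ) * (2 / n) = 4 * Fate.changes k / n by ring,
        div_le_iff₀ hn]
      linarith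
    refine (measure_lt_abs_sub_le hL (hm.trans c2) hv (by linarith)).trans
      (ENNReal.ofReal_le_ofReal ?_)
    rw [show 2 * 2 = 4 from rfl, t4]
    simp only [Nat.factorial, Nat.succ_eq_add_one]
    push_cast
    rw [div_le_iff₀ (by nlinarith), show τ - τ / 2 = τ / 2 by ring]
    field_simp
    nlinarith
  have e3 : P {w | τ < |(∑ i with i < M.partner i, (w i).1 * (w (M.partner i)).1) - 1 / 2|} ≤
      ENNReal.ofReal (1 / 8) := by
    have hm := Fate.abs_integral_sum_partner_sub_le ht k M
    have hv := Fate.variance_sum_partner_le ht k M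
    have hL := Fate.memLp_sum_partner ht k M
    rw [htn] at hm
    have c1 : (n : ℝ) / 2 * (1 / n) = 1 / 2 := by field_simp
    rw [c1] at hm
    have c2 : 2 * (Fate.changes k : ℝ) * (1 / n) ≤ τ / 2 := by
      rw [mul_one_div, div_le_iff₀ hn]
      linarith
    refine (measure_lt_abs_sub_le hL (hm.trans c2) hv (by linarith)).trans
      (ENNReal.ofReal_le_ofReal ?_)
    rw [t4]
    rw [div_le_iff₀ (by nlinarith), show τ - τ / 2 = τ / 2 by ring]
    field_simp
    nlinarith
  have e4 : P {w | ∃ i, L < (k i).top (w i)} ≤ ENNReal.ofReal (1 / 8) := by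
    have : {w : Fin n → ℝ × ℝ | ∃ i, L < (k i).top (w i)} =
        ⋃ i ∈ Finset.univ, {w | L < (k i).top (w i)} := by
      ext w; simp
    rw [this]
    refine (measure_biUnion_finset_le _ _).trans ?_
    have hb : ∀ i ∈ Finset.univ, P {w | L < (k i).top (w i)} ≤
        ENNReal.ofReal (4 * Real.exp (-(t * L / 2))) := by
      intro i _
      refine le_trans (le_of_eq ?_) ((k i).law_top_gt_le ht L)
      exact (measurePreserving_eval (fun i => (k i).law t) i).measure_preimage
        (measurableSet_lt measurable_const (k i).measurable_top).nullMeasurableSet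
    refine (Finset.sum_le_sum hb).trans ?_
    rw [Finset.sum_const, Finset.card_univ, Fintype.card_fin, nsmul_eq_mul,
      ← ENNReal.ofReal_natCast, ← ENNReal.ofReal_mul (by positivity)]
    apply ENNReal.ofReal_le_ofReal
    linarith
  have hcompl : P (typicalPairs M k t τ L)ᶜ ≤ ENNReal.ofReal (1 / 2) := by
    have hsub : (typicalPairs M k t τ L)ᶜ ⊆ ({w | 10 < |(∑ i, (w i).1) - t|} ∪
        {w | ∃ i, L < (k i).top (w i)}) ∪
        ({w | τ < |(∑ i with i < M.partner i, (w i).1 * (w (M.partner i)).1) - 1 / 2|} ∪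
        {w | τ < |(∑ i, (w i).1 ^ 2) - 2|}) := by
      intro w hw
      by_contra hc
      simp only [Set.mem_union, Set.mem_ofPred_eq, not_or, not_lt, not_exists] at hc
      exact hw ⟨hc.1.1, hc.1.2, hc.2.1, hc.2.2⟩
    refine (measure_mono hsub).trans ((measure_union_le _ _).trans ((add_le_add
      ((measure_union_le _ _).trans (add_le_add e1 e4))
      ((measure_union_le _ _).trans (add_le_add e3 e2))).trans ?_))
    rw [← ENNReal.ofReal_add (by norm_num) (by norm_num),
      ← ENNReal.ofReal_add (by norm_num) (by norm_num)]
    apply ENNReal.ofReal_le_ofReal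
    norm_num
  have hsum := prob_add_prob_compl (μ := P) (measurableSet_typicalPairs M k t τ L)
  have : ENNReal.ofReal (1 / 2) + ENNReal.ofReal (1 / 2) ≤
      P (typicalPairs M k t τ L) + ENNReal.ofReal (1 / 2) := by
    rw [← ENNReal.ofReal_add (by norm_num) (by norm_num)]
    norm_num
    rw [← hsum]
    gcongr
  exact (ENNReal.add_le_add_iff_right ENNReal.ofReal_ne_top).1 this

namespace PerfectMatching

variable {n : ℕ}

theorem mem_diffNodes {M N : PerfectMatching n} {i : Fin n} :
    i ∈ M.diffNodes N ↔ N.partner i ≠ M.partner i := by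
  simp [diffNodes]

theorem partner_mem_diffNodes {M N : PerfectMatching n} {i : Fin n} (hi : i ∈ M.diffNodes N) :
    M.partner i ∈ M.diffNodes N := by
  rw [mem_diffNodes] at *
  intro h
  rw [M.partner_partner] at h
  exact hi (by rw [← h, N.partner_partner, h])

theorem partner_mem_diffNodes_iff {M N : PerfectMatching n} {i : Fin n} :
    M.partner i ∈ M.diffNodes N ↔ i ∈ M.diffNodes N :=
  ⟨fun h => M.partner_partner i ▸ partner_mem_diffNodes h, partner_mem_diffNodes⟩

theorem partner_mem_diffNodes' {M N : PerfectMatching n} {i : Fin n} (hi : i ∈ M.diffNodes N) :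
    N.partner i ∈ M.diffNodes N := by
  rw [mem_diffNodes] at *
  intro h
  rw [N.partner_partner] at h
  exact hi (by conv_rhs => rw [h, M.partner_partner])

/-- The possible sets of vertices that are better off in `N` than in `M` if both are stable: every
edge of `M` that is lost has a better-off vertex, and every new edge a worse-off one. -/
def orientations (M N : PerfectMatching n) : Finset (Finset (Fin n)) :=
  (M.diffNodes N).powerset.filter fun B => ∀ i ∈ M.diffNodes N,
    (i ∈ B ∨ M.partner i ∈ B) ∧ (i ∉ B ∨ N.partner i ∉ B)

/-- The fates of the vertices if the partners change on `V` and the set of better-off vertices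
is `B`. -/
def fate (V B : Finset (Fin n)) (i : Fin n) : Fate :=
  if i ∈ V then if i ∈ B then Fate.better else Fate.worse else Fate.same

/-- The larger values of the value pairs `w`. -/
def topValues (k : Fin n → Fate) (w : Fin n → ℝ × ℝ) (i : Fin n) : ℝ := (k i).top (w i)

theorem value_glue_left (M N : PerfectMatching n) (w : Fin n → ℝ × ℝ) (Y : PrefArray n)
    (i : Fin n) : M.value (M.glue N w Y) i = (w i).1 := by
  simp [value, glue]

theorem value_glue_right (M N : PerfectMatching n) (w : Fin n → ℝ × ℝ) (Y : PrefArray n)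
    {i : Fin n} (hi : i ∈ M.diffNodes N) : N.value (M.glue N w Y) i = (w i).2 := by
  rw [mem_diffNodes] at hi
  simp [value, glue, hi.symm]

theorem glue_left (M N : PerfectMatching n) (w : Fin n → ℝ × ℝ) (Y : PrefArray n)
    {i j : Fin n} (hij : i ≠ j) (h : M.partner i = j) : M.glue N w Y ⟨(i, j), hij⟩ = (w i).1 := by
  simp [glue, h]

theorem glue_right (M N : PerfectMatching n) (w : Fin n → ℝ × ℝ) (Y : PrefArray n)
    {i j : Fin n} (hij : i ≠ j) (hM : M.partner i ≠ j) (h : N.partner i = j) :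
    M.glue N w Y ⟨(i, j), hij⟩ = (w i).2 := by
  simp [glue, h, hM]

theorem glue_other (M N : PerfectMatching n) (w : Fin n → ℝ × ℝ) (Y : PrefArray n)
    {i j : Fin n} (hij : i ≠ j) (hM : M.partner i ≠ j) (hN : N.partner i ≠ j) :
    M.glue N w Y ⟨(i, j), hij⟩ = Y ⟨(i, j), hij⟩ := by
  simp [glue, hM, hN]

theorem partner_ne_symm (M : PerfectMatching n) {i j : Fin n} (h : M.partner i ≠ j) :
    M.partner j ≠ i := fun h' => h (by rw [← h', M.partner_partner])

theorem lt_or_lt_of_mem_unblocked {Q : Finset (UPair n)} {u : Fin n → ℝ} {Y : PrefArray n}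
    (hY : Y ∈ unblocked Q u) {i j : Fin n} (hij : i ≠ j)
    (hQ : ∀ p : UPair n, (p.1 = (i, j) ∨ p.1 = (j, i)) → p ∈ Q) :
    u i < Y ⟨(i, j), hij⟩ ∨ u j < Y ⟨(j, i), hij.symm⟩ := by
  rcases lt_or_gt_of_ne hij with h | h
  · have := hY ⟨(i, j), h⟩ (hQ _ (Or.inl rfl))
    simp only [pairEntries, not_and_or, not_le] at this
    exact this
  · have := hY ⟨(j, i), h⟩ (hQ _ (Or.inr rfl))
    simp only [pairEntries, not_and_or, not_le] at this
    exact this.symm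

theorem glue_mem_stable (M N : PerfectMatching n) {B : Finset (Fin n)}
    (hB : B ∈ M.orientations N) {w : Fin n → ℝ × ℝ} {Y : PrefArray n}
    (hw : ∀ i, w i ∈ (fate (M.diffNodes N) B i).region)
    (hY : Y ∈ unblocked Finset.univ (topValues (fate (M.diffNodes N) B) w)) :
    M.glue N w Y ∈ M.stable ∩ N.stable := by
  simp only [orientations, Finset.mem_filter, Finset.mem_powerset] at hB
  obtain ⟨hBV, hB⟩ := hB
  have hbetter : ∀ i ∈ M.diffNodes N, i ∈ B → (w i).2 < (w i).1 := fun i hi hi' => by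
    have := hw i
    simp only [fate, hi, hi', if_true, Fate.region] at this
    exact this.2
  have hworse : ∀ i ∈ M.diffNodes N, i ∉ B → (w i).1 < (w i).2 := fun i hi hi' => by
    have := hw i
    simp only [fate, hi, hi', if_true, if_false, Fate.region] at this
    exact this.2
  have hM : ∀ i, M.value (M.glue N w Y) i ≤ topValues (fate (M.diffNodes N) B) w i := by
    intro i
    rw [value_glue_left]
    by_cases hi : i ∈ M.diffNodes N
    · by_cases hi' : i ∈ B
      · simp [topValues, fate, hi, hi', Fate.top]
      · simpa [topValues, fate, hi, hi', Fate.top] using (hworse i hi hi').le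
    · simp [topValues, fate, hi, Fate.top]
  have hN : ∀ i, N.value (M.glue N w Y) i ≤ topValues (fate (M.diffNodes N) B) w i := by
    intro i
    by_cases hi : i ∈ M.diffNodes N
    · rw [value_glue_right _ _ _ _ hi]
      by_cases hi' : i ∈ B
      · simpa [topValues, fate, hi, hi', Fate.top] using (hbetter i hi hi').le
      · simp [topValues, fate, hi, hi', Fate.top]
    · have h : N.partner i = M.partner i := by simpa [mem_diffNodes] using hi
      have : N.value (M.glue N w Y) i = (w i).1 := glue_left _ _ _ _ _ h.symm
      rw [this]
      simp [topValues, fate, hi, Fate.top]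
  constructor
  · intro i j hij h
    by_cases hNi : N.partner i = j
    · have hNj : N.partner j = i := by rw [← hNi, N.partner_partner]
      have hi : i ∈ M.diffNodes N := by rw [mem_diffNodes, hNi]; exact h.symm
      have hj : j ∈ M.diffNodes N := hNi ▸ partner_mem_diffNodes' hi
      rw [value_glue_left, value_glue_left, glue_right _ _ _ _ _ h hNi,
        glue_right _ _ _ _ _ (M.partner_ne_symm h) hNj]
      rcases (hB i hi).2 with h1 | h1
      · exact Or.inl (hworse i hi h1)
      · rw [hNi] at h1
        exact Or.inr (hworse j hj h1)
    · rw [glue_other _ _ _ _ _ h hNi,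
        glue_other _ _ _ _ _ (M.partner_ne_symm h) (N.partner_ne_symm hNi)]
      exact (lt_or_lt_of_mem_unblocked hY hij fun _ _ => Finset.mem_univ _).imp
        (hM i).trans_lt (hM j).trans_lt
  · intro i j hij h
    by_cases hMi : M.partner i = j
    · have hMj : M.partner j = i := by rw [← hMi, M.partner_partner]
      have hi : i ∈ M.diffNodes N := by rw [mem_diffNodes, hMi]; exact h
      have hj : j ∈ M.diffNodes N := hMi ▸ partner_mem_diffNodes hi
      rw [value_glue_right _ _ _ _ hi, value_glue_right _ _ _ _ hj, glue_left _ _ _ _ _ hMi,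
        glue_left _ _ _ _ _ hMj]
      rcases (hB i hi).1 with h1 | h1
      · exact Or.inl (hbetter i hi h1)
      · rw [hMi] at h1
        exact Or.inr (hbetter j hj h1)
    · rw [glue_other _ _ _ _ _ hMi h,
        glue_other _ _ _ _ _ (M.partner_ne_symm hMi) (N.partner_ne_symm h)]
      exact (lt_or_lt_of_mem_unblocked hY hij fun _ _ => Finset.mem_univ _).imp
        (hN i).trans_lt (hN j).trans_lt

/-- The pairs that are no edges of `M` and are not contained in `V`. -/
def outerPairs (M : PerfectMatching n) (V : Finset (Fin n)) : Finset (UPair n) :=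
  Finset.univ.filter fun p => M.partner p.1.1 ≠ p.1.2 ∧ ¬(p.1.1 ∈ V ∧ p.1.2 ∈ V)

/-- `M₁₂` arises from `M` by the changes of `M₁` and those of `M₂`. -/
structure IsCombined (M M₁ M₂ M₁₂ : PerfectMatching n) : Prop where
  disjoint : Disjoint (M.diffNodes M₁) (M.diffNodes M₂)
  symmDiff_eq : symmDiff M₁₂.edges M.edges =
    symmDiff M₁.edges M.edges ∪ symmDiff M₂.edges M.edges

namespace IsCombined

variable {M M₁ M₂ M₁₂ : PerfectMatching n}

theorem symm (h : IsCombined M M₁ M₂ M₁₂) : IsCombined M M₂ M₁ M₁₂ :=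
  ⟨h.disjoint.symm, by rw [h.symmDiff_eq, Finset.union_comm]⟩

theorem partner_eq (h : IsCombined M M₁ M₂ M₁₂) {i : Fin n} (hi : i ∉ M.diffNodes M₂) :
    M₁₂.partner i = M₁.partner i := by
  have h0 : M₂.partner i = M.partner i := by simpa [mem_diffNodes] using hi
  have h1 := fun j => Finset.ext_iff.1 h.symmDiff_eq s(i, j)
  simp only [Finset.mem_symmDiff, Finset.mem_union, mem_edges, h0] at h1
  have h2 := h1 (M₁.partner i)
  have h3 := h1 (M₁₂.partner i)
  grind

theorem diffNodes_eq (h : IsCombined M M₁ M₂ M₁₂) :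
    M.diffNodes M₁₂ = M.diffNodes M₁ ∪ M.diffNodes M₂ := by
  ext i
  rw [Finset.mem_union, mem_diffNodes]
  by_cases h2 : i ∈ M.diffNodes M₂
  · have h1 : i ∉ M.diffNodes M₁ := Finset.disjoint_right.1 h.disjoint h2
    rw [h.symm.partner_eq h1, mem_diffNodes, mem_diffNodes]
    rw [mem_diffNodes] at h2
    tauto
  · rw [h.partner_eq h2, ← mem_diffNodes]
    tauto

theorem value_eq (h : IsCombined M M₁ M₂ M₁₂) (X : PrefArray n) {i : Fin n}
    (hi : i ∉ M.diffNodes M₂) : M₁₂.value X i = M₁.value X i := by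
  unfold value
  congr 2
  rw [h.partner_eq hi]

end IsCombined

theorem value_eq_of_notMem_diffNodes {M N : PerfectMatching n} (X : PrefArray n) {i : Fin n}
    (hi : i ∉ M.diffNodes N) : N.value X i = M.value X i := by
  have h0 : N.partner i = M.partner i := by simpa [mem_diffNodes] using hi
  unfold value
  congr 2
  rw [h0]

/-- The unordered pair of two distinct vertices. -/
def upair (a b : Fin n) (h : a ≠ b) : UPair n :=
  if hab : a < b then ⟨(a, b), hab⟩ else ⟨(b, a), lt_of_le_of_ne (not_lt.1 hab) h.symm⟩

theorem upair_notMem_outerPairs (M : PerfectMatching n) {V : Finset (Fin n)} {a b : Fin n}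
    (ha : a ∈ V) (hb : b ∈ V) (h : a ≠ b) : upair a b h ∉ M.outerPairs V := by
  unfold upair
  split_ifs <;> simp [outerPairs, ha, hb]

theorem mem_blockedAt_upair {u : Fin n → ℝ} {Y : PrefArray n} {a b : Fin n} (h : a ≠ b) :
    Y ∈ blockedAt (upair a b h) u ↔ Y ⟨(a, b), h⟩ ≤ u a ∧ Y ⟨(b, a), h.symm⟩ ≤ u b := by
  unfold upair
  split_ifs
  · rfl
  · exact and_comm

theorem mul_upair {u : Fin n → ℝ} {a b : Fin n} (h : a ≠ b) :
    u (upair a b h).1.1 * u (upair a b h).1.2 = u a * u b := by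
  unfold upair
  split_ifs
  · rfl
  · exact mul_comm _ _

/-- The value pairs in which exactly the vertices of `B` are no worse off. -/
def weakRegion (V B : Finset (Fin n)) : Set (Fin n → ℝ × ℝ) :=
  {w | ∀ i ∈ V, (i ∈ B → (w i).2 ≤ (w i).1) ∧ (i ∉ B → (w i).1 ≤ (w i).2)}

section Blocking

variable {M M₁ M₂ M₁₂ : PerfectMatching n}

/-- Two stable matchings one of which is the reference matching determine an orientation. -/
theorem better_mem_orientations {N : PerfectMatching n} {X : PrefArray n} (hM : X ∈ M.stable)
    (hN : X ∈ N.stable) :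
    (M.diffNodes N).filter (fun i => N.value X i ≤ M.value X i) ∈ M.orientations N := by
  simp only [orientations, Finset.mem_filter, Finset.mem_powerset, Finset.filter_subset, true_and]
  intro i hi
  have hi' := mem_diffNodes.1 hi
  constructor
  · rcases hN i (M.partner i) (M.ne_partner i) hi' with h | h
    · exact Or.inl ⟨hi, le_of_lt h⟩
    · refine Or.inr ⟨partner_mem_diffNodes hi, le_of_lt (h.trans_eq ?_)⟩
      unfold value
      congr 2
      rw [M.partner_partner]
  · rcases hM i (N.partner i) (N.ne_partner i) hi'.symm with h | h
    · exact Or.inl fun h' => absurd h (not_lt.2 h'.2)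
    · refine Or.inr fun h' => absurd h (not_lt.2 (le_of_eq_of_le ?_ h'.2))
      unfold value
      congr 2
      rw [N.partner_partner]

theorem exists_blocking (h : IsCombined M M₁ M₂ M₁₂) {X : PrefArray n}
    (hM₁ : X ∈ M₁.stable) (hM₂ : X ∈ M₂.stable) (hM₁₂ : X ∉ M₁₂.stable) :
    ∃ a ∈ M.diffNodes M₁, ∃ b ∈ M.diffNodes M₂, ∃ hab : a ≠ b,
      X ⟨(a, b), hab⟩ ≤ M₁.value X a ∧ X ⟨(b, a), hab.symm⟩ ≤ M₂.value X b := by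
  simp only [stable, Set.mem_ofPred_eq, not_forall, not_or, not_lt] at hM₁₂
  obtain ⟨i, j, hij, hp, hi, hj⟩ := hM₁₂
  have hd : ∀ {i}, i ∈ M.diffNodes M₁ → i ∉ M.diffNodes M₂ :=
    fun {i} hi => Finset.disjoint_left.1 h.disjoint hi
  have h1 : i ∈ M.diffNodes M₁ ∨ j ∈ M.diffNodes M₁ := by
    by_contra! hc
    rw [h.symm.value_eq X hc.1] at hi
    rw [h.symm.value_eq X hc.2] at hj
    rcases hM₂ i j hij (by rwa [← h.symm.partner_eq hc.1]) with h' | h'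
    · exact absurd h' (not_lt.2 hi)
    · exact absurd h' (not_lt.2 hj)
  have h2 : i ∈ M.diffNodes M₂ ∨ j ∈ M.diffNodes M₂ := by
    by_contra! hc
    rw [h.value_eq X hc.1] at hi
    rw [h.value_eq X hc.2] at hj
    rcases hM₁ i j hij (by rwa [← h.partner_eq hc.1]) with h' | h'
    · exact absurd h' (not_lt.2 hi)
    · exact absurd h' (not_lt.2 hj)
  rcases h1 with h1 | h1
  · have hj2 : j ∈ M.diffNodes M₂ := h2.resolve_left (hd h1)
    refine ⟨i, h1, j, hj2, hij, ?_, ?_⟩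
    · rwa [h.value_eq X (hd h1)] at hi
    · rwa [h.symm.value_eq X fun hc => hd hc hj2] at hj
  · have hi2 : i ∈ M.diffNodes M₂ := h2.resolve_right (hd h1)
    refine ⟨j, h1, i, hi2, hij.symm, ?_, ?_⟩
    · rwa [h.value_eq X (hd h1)] at hj
    · rwa [h.symm.value_eq X fun hc => hd hc hi2] at hi

theorem exists_of_glue_mem (h : IsCombined M M₁ M₂ M₁₂) {w : Fin n → ℝ × ℝ} {Y : PrefArray n}
    (hM : M.glue M₁₂ w Y ∈ M.stable) (hM₁ : M.glue M₁₂ w Y ∈ M₁.stable)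
    (hM₂ : M.glue M₁₂ w Y ∈ M₂.stable) (hM₁₂ : M.glue M₁₂ w Y ∉ M₁₂.stable) :
    ∃ a ∈ M.diffNodes M₁, ∃ b ∈ M.diffNodes M₂, ∃ B₁ ∈ M.orientations M₁,
      ∃ B₂ ∈ M.orientations M₂, ∃ hab : a ≠ b, a ∉ B₁ ∪ B₂ ∧ b ∉ B₁ ∪ B₂ ∧
        w ∈ weakRegion (M.diffNodes M₁₂) (B₁ ∪ B₂) ∧
        Y ∈ unblocked (M.outerPairs (M.diffNodes M₁₂))
            (topValues (fate (M.diffNodes M₁₂) (B₁ ∪ B₂)) w) ∩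
          blockedAt (upair a b hab) (topValues (fate (M.diffNodes M₁₂) (B₁ ∪ B₂)) w) := by
  obtain ⟨a, ha, b, hb, hab, hXa, hXb⟩ := exists_blocking h hM₁ hM₂ hM₁₂
  set X := M.glue M₁₂ w Y with hX
  have hd : ∀ {i}, i ∈ M.diffNodes M₁ → i ∉ M.diffNodes M₂ :=
    fun {i} hi => Finset.disjoint_left.1 h.disjoint hi
  have hV := h.diffNodes_eq
  set V := M.diffNodes M₁₂ with hVdef
  have hVmem : ∀ i, i ∈ V ↔ i ∈ M.diffNodes M₁ ∨ i ∈ M.diffNodes M₂ := fun i => by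
    rw [hV, Finset.mem_union]
  have hx : ∀ i, M.value X i = (w i).1 := fun i => value_glue_left M M₁₂ w Y i
  have hy1 : ∀ i ∈ M.diffNodes M₁, M₁.value X i = (w i).2 := fun i hi => by
    rw [← h.value_eq X (hd hi)]
    exact value_glue_right M M₁₂ w Y ((hVmem i).2 (Or.inl hi))
  have hy2 : ∀ i ∈ M.diffNodes M₂, M₂.value X i = (w i).2 := fun i hi => by
    rw [← h.symm.value_eq X fun hc => hd hc hi]
    exact value_glue_right M M₁₂ w Y ((hVmem i).2 (Or.inr hi))
  set B₁ := (M.diffNodes M₁).filter (fun i => M₁.value X i ≤ M.value X i) with hB₁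
  set B₂ := (M.diffNodes M₂).filter (fun i => M₂.value X i ≤ M.value X i) with hB₂
  have hBmem : ∀ i ∈ V, (i ∈ B₁ ∪ B₂ ↔ (w i).2 ≤ (w i).1) := by
    intro i hi
    rw [Finset.mem_union, hB₁, hB₂, Finset.mem_filter, Finset.mem_filter]
    rcases (hVmem i).1 hi with h1 | h2
    · rw [hy1 i h1, hx]
      have := hd h1
      tauto
    · rw [hy2 i h2, hx]
      have : i ∉ M.diffNodes M₁ := fun hc => hd hc h2
      tauto
  have haV : a ∈ V := (hVmem a).2 (Or.inl ha)
  have hbV : b ∈ V := (hVmem b).2 (Or.inr hb)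
  have hMab : M.partner a ≠ b := fun hc => hd (partner_mem_diffNodes ha) (hc ▸ hb)
  have hM1ab : M₁.partner a ≠ b := fun hc => hd (partner_mem_diffNodes' ha) (hc ▸ hb)
  have hM2ba : M₂.partner b ≠ a := fun hc => hd ha (hc ▸ partner_mem_diffNodes' hb)
  have hM12ab : M₁₂.partner a ≠ b := by rwa [h.partner_eq (hd ha)]
  have hXYab : X ⟨(a, b), hab⟩ = Y ⟨(a, b), hab⟩ := glue_other M M₁₂ w Y hab hMab hM12ab
  have hXYba : X ⟨(b, a), hab.symm⟩ = Y ⟨(b, a), hab.symm⟩ :=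
    glue_other M M₁₂ w Y hab.symm (M.partner_ne_symm hMab) (M₁₂.partner_ne_symm hM12ab)
  have hbB : b ∉ B₁ ∪ B₂ := by
    rw [hBmem b hbV, not_le]
    rcases hM₁ a b hab hM1ab with h' | h'
    · exact absurd h' (not_lt.2 hXa)
    · rw [value_eq_of_notMem_diffNodes X fun hc => hd hc hb, hx] at h'
      rw [hy2 b hb] at hXb
      exact h'.trans_le hXb
  have haB : a ∉ B₁ ∪ B₂ := by
    rw [hBmem a haV, not_le]
    rcases hM₂ b a hab.symm hM2ba with h' | h'
    · exact absurd h' (not_lt.2 hXb)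
    · rw [value_eq_of_notMem_diffNodes X (hd ha), hx] at h'
      rw [hy1 a ha] at hXa
      exact h'.trans_le hXa
  have htopx : ∀ i, i ∉ V ∨ i ∈ B₁ ∪ B₂ → topValues (fate V (B₁ ∪ B₂)) w i = (w i).1 := by
    intro i hi
    by_cases hiV : i ∈ V
    · have hiB := hi.resolve_left (not_not.2 hiV)
      simp only [topValues, fate, hiV, hiB, if_true, Fate.top]
    · simp only [topValues, fate, hiV, if_false, Fate.top]
  have htopy : ∀ i, i ∈ V → i ∉ B₁ ∪ B₂ → topValues (fate V (B₁ ∪ B₂)) w i = (w i).2 := by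
    intro i hiV hiB
    simp only [topValues, fate, hiV, hiB, if_true, if_false, Fate.top]
  refine ⟨a, ha, b, hb, B₁, better_mem_orientations hM hM₁, B₂, better_mem_orientations hM hM₂,
    hab, haB, hbB, ?_, ?_, ?_⟩
  · intro i hi
    rw [hBmem i hi]
    exact ⟨id, fun hc => (not_le.1 hc).le⟩
  · have key : ∀ i j (hij : i ≠ j), M.partner i ≠ j → j ∉ V →
        topValues (fate V (B₁ ∪ B₂)) w i < Y ⟨(i, j), hij⟩ ∨
          topValues (fate V (B₁ ∪ B₂)) w j < Y ⟨(j, i), hij.symm⟩ := by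
      intro i j hij hMij hj
      have hM12ij : M₁₂.partner i ≠ j := by
        intro hc
        refine hj (hc ▸ partner_mem_diffNodes' ?_)
        rw [mem_diffNodes, hc]
        exact hMij.symm
      have e1 : X ⟨(i, j), hij⟩ = Y ⟨(i, j), hij⟩ := glue_other M M₁₂ w Y hij hMij hM12ij
      have e2 : X ⟨(j, i), hij.symm⟩ = Y ⟨(j, i), hij.symm⟩ :=
        glue_other M M₁₂ w Y hij.symm (M.partner_ne_symm hMij) (M₁₂.partner_ne_symm hM12ij)
      rw [htopx j (Or.inl hj), ← e1, ← e2]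
      rw [hVmem, not_or] at hj
      by_cases hi : i ∉ V ∨ i ∈ B₁ ∪ B₂
      · rw [htopx i hi, ← hx, ← hx]
        exact hM i j hij hMij
      · rw [not_or, not_not] at hi
        rw [htopy i hi.1 hi.2]
        rcases (hVmem i).1 hi.1 with h1 | h2
        · rw [← hy1 i h1, ← hx j, ← value_eq_of_notMem_diffNodes X hj.1]
          exact hM₁ i j hij (by rwa [← h.partner_eq (hd h1)])
        · rw [← hy2 i h2, ← hx j, ← value_eq_of_notMem_diffNodes X hj.2]
          exact hM₂ i j hij (by rwa [← h.symm.partner_eq fun hc => hd hc h2])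
    rintro ⟨⟨i, j⟩, hij⟩ hp
    simp only [outerPairs, Finset.mem_filter, Finset.mem_univ, true_and, not_and_or] at hp
    have hij' : i < j := hij
    simp only [pairEntries, not_and_or, not_le]
    rcases hp.2 with hp2 | hp2
    · exact (key j i hij'.ne' (M.partner_ne_symm hp.1) hp2).symm
    · exact key i j hij'.ne hp.1 hp2
  · rw [mem_blockedAt_upair, htopy a haV haB, htopy b hbV hbB, ← hXYab, ← hXYba, ← hy1 a ha,
      ← hy2 b hb]
    exact ⟨hXa, hXb⟩

end Blocking

end PerfectMatching

theorem sum_UPair_symm {n : ℕ} (f : Fin n → Fin n → ℝ) (hf : ∀ i j, f i j = f j i) :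
    2 * ∑ p : UPair n, f p.1.1 p.1.2 = ∑ i, ∑ j, if i ≠ j then f i j else 0 := by
  have h := sum_offDiag_eq fun p : OffDiag n => f p.1.1 p.1.2
  have h2 : ∑ p : UPair n, (f p.1.1 p.1.2 + f p.1.2 p.1.1) = 2 * ∑ p : UPair n, f p.1.1 p.1.2 := by
    rw [Finset.mul_sum]
    exact Finset.sum_congr rfl fun p _ => by rw [hf p.1.2 p.1.1, two_mul]
  rw [← h2, ← h, ← Fintype.sum_prod_type' (f := fun i j => if i ≠ j then f i j else 0),
    ← Finset.sum_filter]
  exact (Finset.sum_subtype _ (fun p => by simp) fun p : Fin n × Fin n => f p.1 p.2).symm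

theorem sum_mul_UPair_le {n : ℕ} {u : Fin n → ℝ} (hu : ∀ i, 0 ≤ u i) :
    2 * ∑ p : UPair n, u p.1.1 * u p.1.2 ≤ (∑ i, u i) ^ 2 := by
  rw [sum_UPair_symm (fun i j => u i * u j) fun i j => mul_comm _ _, sq, Finset.sum_mul_sum]
  refine Finset.sum_le_sum fun i _ => Finset.sum_le_sum fun j _ => ?_
  split_ifs
  · exact le_rfl
  · exact mul_nonneg (hu i) (hu j)

theorem exp_neg_le_one_sub {s : ℝ} (h1 : s ≤ 1 / 2) :
    Real.exp (-(s + 2 * s ^ 2)) ≤ 1 - s := by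
  have hp : 0 < 1 - s := by linarith
  rw [← Real.le_log_iff_exp_le hp]
  refine le_trans ?_ (Real.one_sub_inv_le_log_of_pos hp)
  rw [le_sub_iff_add_le, ← le_sub_iff_add_le', inv_le_iff_one_le_mul₀ hp]
  nlinarith [mul_nonneg (sq_nonneg s) hp.le]

theorem exp_le_prod_one_sub_mul {n : ℕ} {u : Fin n → ℝ} (hu : ∀ i, 0 ≤ u i)
    (hu' : ∀ i, u i ≤ 1 / 2) :
    Real.exp (-((∑ i, u i) ^ 2 / 2 + (∑ i, u i ^ 2) ^ 2)) ≤
      ∏ p ∈ (Finset.univ : Finset (UPair n)), (1 - u p.1.1 * u p.1.2) := by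
  have h1 := sum_mul_UPair_le hu
  have h2 := sum_mul_UPair_le (n := n) (u := fun i => u i ^ 2) fun i => sq_nonneg _
  have h3 : ∀ p : UPair n, Real.exp (-(u p.1.1 * u p.1.2 + 2 * (u p.1.1 ^ 2 * u p.1.2 ^ 2))) ≤
      1 - u p.1.1 * u p.1.2 := fun p => by
    rw [← mul_pow]
    exact exp_neg_le_one_sub
      (by nlinarith [hu p.1.1, hu p.1.2, hu' p.1.1, hu' p.1.2])
  refine le_trans ?_ (Finset.prod_le_prod (fun p _ => (Real.exp_pos _).le) fun p _ => h3 p)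
  rw [← Real.exp_sum]
  apply Real.exp_le_exp.2
  rw [Finset.sum_neg_distrib, Finset.sum_add_distrib, ← Finset.mul_sum]
  linarith

namespace PerfectMatching

variable {n : ℕ}

theorem sum_outerPairs_ge (M : PerfectMatching n) {V : Finset (Fin n)}
    (hV : ∀ i, M.partner i ∈ V ↔ i ∈ V) {u : Fin n → ℝ} (hu : ∀ i, 0 ≤ u i) :
    (∑ i ∈ V, u i) * (∑ i ∈ Vᶜ, u i) + (∑ i ∈ Vᶜ, u i) ^ 2 / 2 - ∑ i ∈ Vᶜ, u i ^ 2 ≤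
      ∑ p ∈ M.outerPairs V, u p.1.1 * u p.1.2 := by
  let a : Fin n → ℝ := fun i => if i ∈ V then u i else 0
  let b : Fin n → ℝ := fun i => if i ∈ V then 0 else u i
  have hsum : ∀ f : Fin n → ℝ, ∑ i ∈ Vᶜ, f i = ∑ i, if i ∈ V then 0 else f i := fun f => by
    rw [← Finset.sum_filter_add_sum_filter_not Finset.univ (fun i => i ∈ V)
      (fun i => if i ∈ V then 0 else f i)]
    rw [Finset.sum_eq_zero (s := Finset.univ.filter fun i => i ∈ V) (by
      intro i hi; simp only [Finset.mem_filter] at hi; simp [hi.2]), zero_add]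
    refine Finset.sum_congr (by ext; simp) fun i hi => ?_
    simp only [Finset.mem_filter] at hi
    simp [hi.2]
  have hsumV : ∑ i ∈ V, u i = ∑ i, a i := by
    simp [a, Finset.sum_ite_mem]
  have hsumb : ∑ i ∈ Vᶜ, u i = ∑ i, b i := hsum u
  have hsumb2 : ∑ i ∈ Vᶜ, u i ^ 2 = ∑ i, b i ^ 2 := by
    rw [hsum]
    refine Finset.sum_congr rfl fun i _ => ?_
    by_cases hi : i ∈ V <;> simp [b, hi]
  have hperm : ∑ i, b (M.partner i) ^ 2 = ∑ i, b i ^ 2 :=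
    Equiv.sum_comp (Function.Involutive.toPerm M.partner M.partner_partner) fun i => b i ^ 2
  let g : Fin n → Fin n → ℝ := fun i j =>
    if M.partner i ≠ j ∧ ¬(i ∈ V ∧ j ∈ V) then u i * u j else 0
  have hg : ∀ i j, g i j = g j i := fun i j => by
    have e : (M.partner i ≠ j ∧ ¬(i ∈ V ∧ j ∈ V)) ↔ (M.partner j ≠ i ∧ ¬(j ∈ V ∧ i ∈ V)) := by
      rw [and_comm (a := i ∈ V)]
      exact and_congr_left fun _ => ⟨M.partner_ne_symm, M.partner_ne_symm⟩
    simp only [g, e, mul_comm (u i)]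
  have hQ : 2 * ∑ p ∈ M.outerPairs V, u p.1.1 * u p.1.2 =
      ∑ i, ∑ j, if i ≠ j then g i j else 0 := by
    rw [← sum_UPair_symm g hg, outerPairs, Finset.sum_filter]
  have hpt : ∀ i j, 2 * (a i * b j) - (a i * b j - b i * a j) + b i * b j -
      (if j = i then b i ^ 2 else 0) - (if j = M.partner i then b i * b (M.partner i) else 0) ≤
      if i ≠ j then g i j else 0 := by
    intro i j
    have hui := hu i
    have huj := hu j
    have huij := mul_nonneg hui huj
    by_cases hij : i = j
    · subst hij
      have := M.ne_partner i
      by_cases hi : i ∈ V <;> simp [a, b, hi, this]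
      nlinarith
    · by_cases hp : M.partner i = j
      · have hji : ¬ j = i := fun h => hij h.symm
        have hVij : j ∈ V ↔ i ∈ V := hp ▸ hV i
        by_cases hi : i ∈ V
        · simp [g, a, b, hi, hp, hij, hVij.2 hi, hji]
        · have hj : j ∉ V := fun h => hi (hVij.1 h)
          simp [g, a, b, hi, hp, hij, hj, hji]
      · have hji : ¬ j = i := fun h => hij h.symm
        have hp' : ¬ j = M.partner i := fun h => hp h.symm
        by_cases hi : i ∈ V <;> by_cases hj : j ∈ V <;>
          simp [g, a, b, hi, hj, hp, hp', hij, hji]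
        linarith
  have hle := Finset.sum_le_sum fun i (_ : i ∈ Finset.univ) =>
    Finset.sum_le_sum fun j (_ : j ∈ Finset.univ) => hpt i j
  rw [← hQ] at hle
  simp only [Finset.sum_add_distrib, Finset.sum_sub_distrib, ← Finset.mul_sum, ← Finset.sum_mul,
    Finset.sum_ite_eq', Finset.mem_univ, if_true] at hle
  have hb : ∑ i, b i * b (M.partner i) ≤ ∑ i, b i ^ 2 := by
    have : ∑ i, b i * b (M.partner i) ≤ ∑ i, (b i ^ 2 + b (M.partner i) ^ 2) / 2 :=
      Finset.sum_le_sum fun i _ => by nlinarith [sq_nonneg (b i - b (M.partner i))]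
    rw [← Finset.sum_div, Finset.sum_add_distrib, hperm] at this
    linarith
  rw [hsumV, hsumb, hsumb2]
  nlinarith

theorem prod_outerPairs_le (M : PerfectMatching n) {V : Finset (Fin n)}
    (hV : ∀ i, M.partner i ∈ V ↔ i ∈ V) {u : Fin n → ℝ} (hu : ∀ i, u i ∈ Set.Icc (0 : ℝ) 1) :
    ∏ p ∈ M.outerPairs V, (1 - u p.1.1 * u p.1.2) ≤
      Real.exp (∑ i ∈ Vᶜ, u i ^ 2 - (∑ i ∈ V, u i) * (∑ i ∈ Vᶜ, u i) -
        (∑ i ∈ Vᶜ, u i) ^ 2 / 2) := by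
  have h1 : ∏ p ∈ M.outerPairs V, (1 - u p.1.1 * u p.1.2) ≤
      ∏ p ∈ M.outerPairs V, Real.exp (-(u p.1.1 * u p.1.2)) :=
    Finset.prod_le_prod (fun p _ => by
      have := mul_le_one₀ (hu p.1.1).2 (hu p.1.2).1 (hu p.1.2).2
      linarith) fun p _ => Real.one_sub_le_exp_neg _
  refine h1.trans ?_
  rw [← Real.exp_sum]
  apply Real.exp_le_exp.2
  rw [Finset.sum_neg_distrib]
  have := M.sum_outerPairs_ge hV fun i => (hu i).1
  linarith

end PerfectMatching

theorem prod_apply_fibers {α β : Type*} [MeasurableSpace α] [MeasurableSpace β] {μ : Measure α}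
    {ν : Measure β} [SFinite ν] {D : Set α} (hD : MeasurableSet D) {S : α → Set β}
    (hS : MeasurableSet {q : α × β | q.2 ∈ S q.1}) :
    (μ.prod ν) {q | q.1 ∈ D ∧ q.2 ∈ S q.1} = ∫⁻ w in D, ν (S w) ∂μ := by
  have he : {q : α × β | q.1 ∈ D ∧ q.2 ∈ S q.1} = Prod.fst ⁻¹' D ∩ {q | q.2 ∈ S q.1} := rfl
  rw [he, Measure.prod_apply ((measurable_fst hD).inter hS), ← lintegral_indicator hD]
  refine lintegral_congr fun w => ?_
  by_cases hw : w ∈ D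
  · rw [Set.indicator_of_mem hw]
    congr 1
    ext Y
    exact ⟨fun h => h.2, fun h => ⟨hw, h⟩⟩
  · rw [Set.indicator_of_notMem hw]
    convert! measure_empty (μ := ν)
    ext Y
    exact ⟨fun h => absurd h.1 hw, fun h => h.elim⟩

namespace PerfectMatching

variable {n : ℕ}

theorem measurable_topValues (k : Fin n → Fate) (i : Fin n) :
    Measurable fun w : Fin n → ℝ × ℝ => topValues k w i :=
  (k i).measurable_top.comp (measurable_pi_apply i)

theorem measurableSet_blockedAt_topValues (k : Fin n → Fate) (p : UPair n) :
    MeasurableSet {q : (Fin n → ℝ × ℝ) × PrefArray n | q.2 ∈ blockedAt p (topValues k q.1)} := by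
  have h1 : MeasurableSet {q : (Fin n → ℝ × ℝ) × PrefArray n |
      q.2 ⟨(p.1.1, p.1.2), p.2.ne⟩ ≤ topValues k q.1 p.1.1} :=
    measurableSet_le (by fun_prop) ((measurable_topValues k _).comp measurable_fst)
  have h2 : MeasurableSet {q : (Fin n → ℝ × ℝ) × PrefArray n |
      q.2 ⟨(p.1.2, p.1.1), p.2.ne'⟩ ≤ topValues k q.1 p.1.2} :=
    measurableSet_le (by fun_prop) ((measurable_topValues k _).comp measurable_fst)
  exact h1.inter h2

theorem measurableSet_unblocked_topValues (k : Fin n → Fate) (Q : Finset (UPair n)) :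
    MeasurableSet {q : (Fin n → ℝ × ℝ) × PrefArray n | q.2 ∈ unblocked Q (topValues k q.1)} := by
  have : {q : (Fin n → ℝ × ℝ) × PrefArray n | q.2 ∈ unblocked Q (topValues k q.1)} =
      ⋂ p ∈ Q, {q | q.2 ∈ blockedAt p (topValues k q.1)}ᶜ := by
    ext q
    simp only [unblocked, blockedAt, Set.mem_ofPred_eq, Set.mem_iInter, Set.mem_compl_iff]
  rw [this]
  exact Finset.measurableSet_biInter _ fun p _ => (measurableSet_blockedAt_topValues k p).compl

theorem fate_same_iff {V B : Finset (Fin n)} {i : Fin n} :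
    fate V B i = Fate.same ↔ i ∉ V := by
  unfold fate
  split_ifs <;> simp_all

theorem changes_fate (V B : Finset (Fin n)) : Fate.changes (fate V B) = V.card := by
  unfold Fate.changes
  congr 1
  ext i
  simp [fate_same_iff]

theorem prod_mass_fate (V B : Finset (Fin n)) (t : ℝ) :
    ∏ i, (fate V B i).mass t = (1 / t) ^ (n + V.card) := by
  have : ∀ i, (fate V B i).mass t = 1 / t * if i ∈ V then 1 / t else 1 := by
    intro i
    unfold fate
    split_ifs <;> simp only [Fate.mass]
    · ring
    · ring
    · ring
  simp only [this, Finset.prod_mul_distrib, Finset.prod_const, Finset.card_univ, Fintype.card_fin,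
    Finset.prod_ite_mem, Finset.univ_inter, pow_add]

/-- The value pairs that are typical and compatible with the fates `k`. -/
def goodPairs (M : PerfectMatching n) (k : Fin n → Fate) (t τ L : ℝ) : Set (Fin n → ℝ × ℝ) :=
  typicalPairs M k t τ L ∩ {w | ∀ i, w i ∈ (k i).region}

theorem measurableSet_goodPairs (M : PerfectMatching n) (k : Fin n → Fate) (t τ L : ℝ) :
    MeasurableSet (goodPairs M k t τ L) := by
  refine (measurableSet_typicalPairs M k t τ L).inter ?_
  rw [Set.ofPred_forall]
  exact MeasurableSet.iInter fun i => measurable_pi_apply i (k i).measurableSet_region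

theorem pi_law_goodPairs {t : ℝ} (ht : 0 < t) (M : PerfectMatching n) (k : Fin n → Fate)
    (τ L : ℝ) :
    Measure.pi (fun i => (k i).law t) (goodPairs M k t τ L) =
      Measure.pi (fun i => (k i).law t) (typicalPairs M k t τ L) := by
  have hp := fun i => (k i).isProbabilityMeasure_law ht
  refine measure_congr ?_
  have hae : ∀ᵐ w ∂Measure.pi (fun i => (k i).law t), ∀ i, w i ∈ (k i).region := by
    rw [ae_all_iff]
    intro i
    exact (measurePreserving_eval (fun i => (k i).law t) i).quasiMeasurePreserving.ae
      ((k i).ae_mem_region (t := t))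
  filter_upwards [hae] with w hw
  apply propext
  exact ⟨fun h => h.1, fun h => ⟨h, hw⟩⟩

theorem _root_.Fate.mem_unit_of_mem_region {k : Fate} {w : ℝ × ℝ} (hw : w ∈ k.region) {L : ℝ}
    (hL : k.top w ≤ L) (hL1 : L ≤ 1) :
    w ∈ Set.Icc (0 : ℝ) 1 ×ˢ Set.Icc (0 : ℝ) 1 ∧ w.1 ≤ k.top w ∧ 0 ≤ k.top w ∧
      (k = Fate.same → k.top w = w.1) := by
  cases k
  · obtain ⟨h1, h2⟩ := hw
    have h1' : 0 < w.1 := h1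
    exact ⟨⟨⟨h1'.le, le_trans hL hL1⟩, ⟨h2.1.le, h2.2.le⟩⟩, le_rfl, h1'.le, fun _ => rfl⟩
  · obtain ⟨h1, h2⟩ := hw
    have hL' : w.1 ≤ L := hL
    exact ⟨⟨⟨by linarith, by linarith⟩, ⟨h1.le, by linarith⟩⟩, le_rfl, by simp only [Fate.top]; linarith, by simp⟩
  · obtain ⟨h1, h2⟩ := hw
    have hL' : w.2 ≤ L := hL
    exact ⟨⟨⟨h1.le, by linarith⟩, ⟨by linarith, by linarith⟩⟩, h2.le, by simp only [Fate.top]; linarith, by simp⟩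

theorem exp_le_prod_of_mem_goodPairs {M : PerfectMatching n} {V B : Finset (Fin n)}
    {t τ L : ℝ} (htn : t ^ 2 = n) (hL : L ≤ 1 / 2) (hvL : V.card * L ≤ 1)
    (hτ : τ ≤ 1) {w : Fin n → ℝ × ℝ} (hw : w ∈ goodPairs M (fate V B) t τ L) :
    Real.exp (n / 2 - 77) * ∏ i, Real.exp (-(t * topValues (fate V B) w i)) ≤
      ∏ p ∈ (Finset.univ : Finset (UPair n)),
        (1 - topValues (fate V B) w p.1.1 * topValues (fate V B) w p.1.2) := by
  obtain ⟨⟨hS, hLw, -, hsq⟩, hreg⟩ := hw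
  have hu := fun i => Fate.mem_unit_of_mem_region (hreg i) (hLw i) (by linarith)
  set u := topValues (fate V B) w with hudef
  have hu0 : ∀ i, 0 ≤ u i := fun i => (hu i).2.2.1
  have huL : ∀ i, u i ≤ L := hLw
  have hx0 : ∀ i, 0 ≤ (w i).1 := fun i => (hu i).1.1.1
  have hxu : ∀ i, (w i).1 ≤ u i := fun i => (hu i).2.1
  have hxu' : ∀ i, i ∉ V → u i = (w i).1 := fun i hi => (hu i).2.2.2 (fate_same_iff.2 hi)
  refine le_trans ?_ (exp_le_prod_one_sub_mul hu0 fun i => (huL i).trans hL)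
  rw [← Real.exp_sum, ← Real.exp_add]
  apply Real.exp_le_exp.2
  rw [Finset.sum_neg_distrib, ← Finset.mul_sum]
  have hdiff : ∑ i, (u i - (w i).1) ≤ V.card * L := by
    rw [← Finset.sum_subset (Finset.subset_univ V) fun i _ hi => by rw [hxu' i hi, sub_self]]
    refine (Finset.sum_le_card_nsmul V _ L fun i _ => ?_).trans_eq (nsmul_eq_mul _ _)
    linarith [huL i, hx0 i]
  have hdiff0 : 0 ≤ ∑ i, (u i - (w i).1) := Finset.sum_nonneg fun i _ => by linarith [hxu i]
  have hdiff2 : ∑ i, (u i ^ 2 - (w i).1 ^ 2) ≤ V.card * L := by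
    rw [← Finset.sum_subset (Finset.subset_univ V) fun i _ hi => by rw [hxu' i hi, sub_self]]
    refine (Finset.sum_le_card_nsmul V _ L fun i _ => ?_).trans_eq (nsmul_eq_mul _ _)
    nlinarith [huL i, hx0 i, hu0 i]
  rw [Finset.sum_sub_distrib] at hdiff hdiff0 hdiff2
  have hq0 : 0 ≤ ∑ i, u i ^ 2 := Finset.sum_nonneg fun i _ => sq_nonneg _
  have hq : ∑ i, u i ^ 2 ≤ 4 := by
    have := (abs_le.1 hsq).2
    linarith
  have hq2 : (∑ i, u i ^ 2) ^ 2 ≤ 16 := by nlinarith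
  have h1 := (abs_le.1 hS).1
  have h2 := (abs_le.1 hS).2
  have h3 : (∑ i, u i - t) ^ 2 ≤ 121 := by nlinarith
  nlinarith

/-- A lower bound for the probability of one orientation. -/
theorem measure_orientation_ge {M : PerfectMatching n} {V B : Finset (Fin n)}
    {t τ L : ℝ} (ht : 0 < t) (htn : t ^ 2 = n) (hL : L ≤ 1 / 2) (hvL : V.card * L ≤ 1)
    (hτ0 : 0 < τ) (hτ : τ ≤ 1) (h1 : (V.card : ℝ) ≤ t)
    (h2 : 8 * V.card ≤ τ * n) (h3 : 3840 ≤ τ ^ 2 * n)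
    (h4 : 32 * (n * Real.exp (-(t * L / 2))) ≤ 1) :
    ENNReal.ofReal (Real.exp (n / 2 - 77) * (1 / t) ^ (n + V.card) * (1 / 2)) ≤
      ((pairLaw n).prod (prefLaw n)) {q | q.1 ∈ goodPairs M (fate V B) t τ L ∧
        q.2 ∈ unblocked Finset.univ (topValues (fate V B) q.1)} := by
  have hm := measurableSet_goodPairs M (fate V B) t τ L
  rw [prod_apply_fibers (S := fun w => unblocked Finset.univ (topValues (fate V B) w)) hm
    (measurableSet_unblocked_topValues _ _)]
  have hmem : ∀ w ∈ goodPairs M (fate V B) t τ L, ∀ i,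
      w i ∈ Set.Icc (0 : ℝ) 1 ×ˢ Set.Icc (0 : ℝ) 1 ∧ 0 ≤ topValues (fate V B) w i := fun w hw i =>
    have := Fate.mem_unit_of_mem_region (hw.2 i) (hw.1.2.1 i) (by linarith)
    ⟨this.1, this.2.2.1⟩
  have hmass : 0 < ∏ i, (fate V B i).mass t := Finset.prod_pos fun i _ => Fate.mass_pos ht _
  have hlow : ∀ w ∈ goodPairs M (fate V B) t τ L,
      ENNReal.ofReal (Real.exp (n / 2 - 77) * ∏ i, (fate V B i).mass t) *
        ENNReal.ofReal (∏ i, Real.exp (-(t * (fate V B i).top (w i))) / (fate V B i).mass t) ≤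
      prefLaw n (unblocked Finset.univ (topValues (fate V B) w)) := by
    intro w hw
    rw [prefLaw_unblocked _ fun i => ⟨(hmem w hw i).2, (hw.1.2.1 i).trans (by linarith)⟩,
      ← ENNReal.ofReal_mul (mul_nonneg (Real.exp_pos _).le hmass.le)]
    apply ENNReal.ofReal_le_ofReal
    refine le_trans (le_of_eq ?_) (exp_le_prod_of_mem_goodPairs htn hL hvL hτ hw)
    rw [Finset.prod_div_distrib]
    simp only [topValues]
    field_simp
  refine le_trans ?_ (setLIntegral_mono' hm hlow)
  rw [lintegral_const_mul' _ _ ENNReal.ofReal_ne_top,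
    ← pi_law_apply_eq_lintegral ht (fate V B) hm (fun w hw i => (hmem w hw i).1)
      (fun w hw => hw.2), pi_law_goodPairs ht, prod_mass_fate, ENNReal.ofReal_mul (by positivity)]
  gcongr
  refine half_le_pi_law_typicalPairs ht htn hτ0 M (fate V B) ?_ ?_ h3 h4
  · rwa [changes_fate]
  · rwa [changes_fate]

theorem glue_mem_quasirandom {M N : PerfectMatching n} {k : Fin n → Fate} {τ L : ℝ}
    (hL : L = (Real.log n) ^ 2 / √(n : ℝ)) (hL1 : L ≤ 1) (hτ : τ = (n : ℝ) ^ (-(1 / 3) : ℝ))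
    (hlog : 1 ≤ Real.log n) {w : Fin n → ℝ × ℝ} (hw : w ∈ goodPairs M k √(n : ℝ) τ L)
    (Y : PrefArray n) : M.glue N w Y ∈ M.quasirandom := by
  obtain ⟨⟨hS, hLw, hpart, hsq⟩, hreg⟩ := hw
  simp only [quasirandom, Set.mem_ofPred_eq, value_glue_left]
  refine ⟨hS.trans (by linarith), fun i => ?_, hτ ▸ hpart, hτ ▸ hsq⟩
  have := Fate.mem_unit_of_mem_region (hreg i) (hLw i) hL1
  exact (this.2.1.trans (hLw i)).trans_eq hL

/-- Lower bound for the probability that `M` and `N` are stable and `M` is quasirandom. -/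
theorem measure_stable_inter_ge {M N : PerfectMatching n} {τ L : ℝ} (hn : 0 < n)
    (hLdef : L = (Real.log n) ^ 2 / √(n : ℝ)) (hτdef : τ = (n : ℝ) ^ (-(1 / 3) : ℝ))
    (hlog : 1 ≤ Real.log n) (hL : L ≤ 1 / 2)
    (hvL : (M.diffNodes N).card * L ≤ 1) (hτ : τ ≤ 1) (h1 : ((M.diffNodes N).card : ℝ) ≤ √(n : ℝ))
    (h2 : 8 * (M.diffNodes N).card ≤ τ * n) (h3 : 3840 ≤ τ ^ 2 * n)
    (h4 : 32 * (n * Real.exp (-(√(n : ℝ) * L / 2))) ≤ 1) :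
    ENNReal.ofReal ((M.orientations N).card * (Real.exp (n / 2 - 77) *
      (1 / √(n : ℝ)) ^ (n + (M.diffNodes N).card) * (1 / 2))) ≤
      prefLaw n (M.stable ∩ (N.stable ∩ M.quasirandom)) := by
  have hn' : (0 : ℝ) < n := by exact_mod_cast hn
  have ht : 0 < √(n : ℝ) := Real.sqrt_pos.2 hn'
  have htn : √(n : ℝ) ^ 2 = n := Real.sq_sqrt hn'.le
  have hτ0 : 0 < τ := hτdef ▸ Real.rpow_pos_of_pos hn' _
  set V := M.diffNodes N
  let F : Finset (Fin n) → Set ((Fin n → ℝ × ℝ) × PrefArray n) := fun B =>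
    {q | q.1 ∈ goodPairs M (fate V B) √(n : ℝ) τ L ∧
        q.2 ∈ unblocked Finset.univ (topValues (fate V B) q.1)}
  have hF : ∀ B, MeasurableSet (F B) := fun B =>
    (measurable_fst (measurableSet_goodPairs _ _ _ _ _)).inter
      (measurableSet_unblocked_topValues _ _)
  have hsub : (⋃ B ∈ M.orientations N, F B) ⊆
      (fun q : (Fin n → ℝ × ℝ) × PrefArray n => M.glue N q.1 q.2) ⁻¹'
        (M.stable ∩ (N.stable ∩ M.quasirandom)) := by
    intro q hq
    simp only [Set.mem_iUnion] at hq
    obtain ⟨B, hB, hq⟩ := hq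
    have hst := glue_mem_stable M N hB hq.1.2 hq.2
    exact ⟨hst.1, hst.2, glue_mem_quasirandom hLdef (by linarith) hτdef hlog hq.1 q.2⟩
  have hdisj : Set.PairwiseDisjoint (M.orientations N : Set (Finset (Fin n))) F := by
    intro B hB B' hB' hne
    refine Set.disjoint_left.2 fun q hq hq' => hne ?_
    have hBV : B ⊆ V := Finset.mem_powerset.1 (Finset.mem_filter.1 hB).1
    have hBV' : B' ⊆ V := Finset.mem_powerset.1 (Finset.mem_filter.1 hB').1
    have key : ∀ B, q ∈ F B → ∀ i ∈ V, i ∈ B ↔ (q.1 i).2 < (q.1 i).1 := by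
      intro B hq i hi
      have := hq.1.2 i
      by_cases hiB : i ∈ B
      · simp only [fate, hi, hiB, if_true, Fate.region] at this
        exact ⟨fun _ => this.2, fun _ => hiB⟩
      · simp only [fate, hi, hiB, if_true, if_false, Fate.region] at this
        exact ⟨fun h => absurd h hiB, fun h => absurd this.2 h.not_gt⟩
    ext i
    by_cases hi : i ∈ V
    · rw [key B hq i hi, key B' hq' i hi]
    · exact ⟨fun h => absurd (hBV h) hi, fun h => absurd (hBV' h) hi⟩
  have hmp := measurePreserving_glue M N
  calc _ = ∑ B ∈ M.orientations N, ENNReal.ofReal (Real.exp (n / 2 - 77) *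
      (1 / √(n : ℝ)) ^ (n + V.card) * (1 / 2)) := by
        rw [Finset.sum_const, nsmul_eq_mul, ENNReal.ofReal_mul (by positivity),
          ENNReal.ofReal_natCast]
    _ ≤ ∑ B ∈ M.orientations N, ((pairLaw n).prod (prefLaw n)) (F B) :=
        Finset.sum_le_sum fun B _ => measure_orientation_ge ht htn hL hvL hτ0 hτ h1 h2 h3 h4
    _ = ((pairLaw n).prod (prefLaw n)) (⋃ B ∈ M.orientations N, F B) :=
        (measure_biUnion_finset hdisj fun B _ => hF B).symm
    _ ≤ _ := measure_mono hsub
    _ ≤ Measure.map (fun q : (Fin n → ℝ × ℝ) × PrefArray n => M.glue N q.1 q.2)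
          ((pairLaw n).prod (prefLaw n)) (M.stable ∩ (N.stable ∩ M.quasirandom)) :=
        Measure.le_map_apply hmp.measurable.aemeasurable _
    _ = _ := by rw [hmp.map_eq]

end PerfectMatching

namespace PerfectMatching

variable {n : ℕ}

theorem measurable_value (M : PerfectMatching n) (i : Fin n) :
    Measurable fun X : PrefArray n => M.value X i := measurable_pi_apply _

theorem measurableSet_stable (M : PerfectMatching n) : MeasurableSet M.stable := by
  have : M.stable = ⋂ i : Fin n, ⋂ j : Fin n, ⋂ hij : i ≠ j, ⋂ _ : M.partner i ≠ j,
      ({X | M.value X i < X ⟨(i, j), hij⟩} ∪ {X | M.value X j < X ⟨(j, i), hij.symm⟩}) := by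
    ext X
    simp only [stable, Set.mem_ofPred_eq, Set.mem_iInter, Set.mem_union]
  rw [this]
  refine MeasurableSet.iInter fun i => MeasurableSet.iInter fun j => MeasurableSet.iInter fun hij =>
    MeasurableSet.iInter fun _ => MeasurableSet.union ?_ ?_
  · exact measurableSet_lt (M.measurable_value i) (measurable_pi_apply _)
  · exact measurableSet_lt (M.measurable_value j) (measurable_pi_apply _)

theorem measurableSet_quasirandom (M : PerfectMatching n) : MeasurableSet M.quasirandom := by
  have hv := M.measurable_value
  have h1 : MeasurableSet {X : PrefArray n |
      |(∑ i, M.value X i) - √(n : ℝ)| ≤ 10 * Real.log n} :=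
    measurableSet_le (by fun_prop) measurable_const
  have h2 : MeasurableSet {X : PrefArray n |
      ∀ i, M.value X i ≤ (Real.log n) ^ 2 / √(n : ℝ)} := by
    rw [Set.ofPred_forall]
    exact MeasurableSet.iInter fun i => measurableSet_le (hv i) measurable_const
  have h3 : MeasurableSet {X : PrefArray n |
      |(∑ i with i < M.partner i, M.value X i * M.value X (M.partner i)) - 1 / 2|
        ≤ (n : ℝ) ^ (-(1 / 3) : ℝ)} :=
    measurableSet_le (by fun_prop) measurable_const
  have h4 : MeasurableSet {X : PrefArray n |
      |(∑ i, (M.value X i) ^ 2) - 2| ≤ (n : ℝ) ^ (-(1 / 3) : ℝ)} :=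
    measurableSet_le (by fun_prop) measurable_const
  exact h1.inter (h2.inter (h3.inter h4))

theorem ae_pairLaw_mem_unit :
    ∀ᵐ w ∂(pairLaw n), ∀ i, w i ∈ Set.Icc (0 : ℝ) 1 ×ˢ Set.Icc (0 : ℝ) 1 := by
  rw [ae_all_iff]
  intro i
  have h : ∀ᵐ z ∂(unitLaw.prod unitLaw), z ∈ Set.Icc (0 : ℝ) 1 ×ˢ Set.Icc (0 : ℝ) 1 := by
    rw [unitLaw_prod_eq_restrict]
    exact ae_restrict_mem (measurableSet_Icc.prod measurableSet_Icc)
  exact (measurePreserving_eval (fun _ : Fin n => unitLaw.prod unitLaw)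
    i).quasiMeasurePreserving.ae h

/-- The value pairs in the unit square that have the behaviour of the old values which matters for
the upper bound. -/
def boundedPairs (V B : Finset (Fin n)) (T : ℝ) : Set (Fin n → ℝ × ℝ) :=
  {w | ∀ i, w i ∈ Set.Icc (0 : ℝ) 1 ×ˢ Set.Icc (0 : ℝ) 1} ∩
    ({w | T ≤ ∑ i ∈ Vᶜ, (w i).1} ∩ ({w | ∑ i ∈ Vᶜ, (w i).1 ^ 2 ≤ 3} ∩ weakRegion V B))

theorem measurableSet_weakRegion (V B : Finset (Fin n)) : MeasurableSet (weakRegion V B) := by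
  have : weakRegion V B = ⋂ i ∈ V, if i ∈ B then {w : Fin n → ℝ × ℝ | (w i).2 ≤ (w i).1} else
      {w | (w i).1 ≤ (w i).2} := by
    ext w
    simp only [weakRegion, Set.mem_ofPred_eq, Set.mem_iInter]
    refine forall_congr' fun i => forall_congr' fun _ => ?_
    by_cases hi : i ∈ B <;> simp [hi]
  rw [this]
  refine Finset.measurableSet_biInter _ fun i _ => ?_
  split_ifs
  · exact measurableSet_le (by fun_prop) (by fun_prop)
  · exact measurableSet_le (by fun_prop) (by fun_prop)

theorem measurableSet_boundedPairs (V B : Finset (Fin n)) (T : ℝ) :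
    MeasurableSet (boundedPairs V B T) := by
  refine MeasurableSet.inter ?_ (MeasurableSet.inter ?_ (MeasurableSet.inter ?_
    (measurableSet_weakRegion V B)))
  · rw [Set.ofPred_forall]
    exact MeasurableSet.iInter fun i =>
      measurable_pi_apply i (measurableSet_Icc.prod measurableSet_Icc)
  · exact measurableSet_le measurable_const (by fun_prop)
  · exact measurableSet_le (by fun_prop) measurable_const

/-- A bound for the density contribution of one vertex. -/
noncomputable def vertexWeight (t T : ℝ) (m : ℕ) (k : Fate) : ℝ × ℝ → ENNReal :=
  match k with
  | Fate.same => fun w => ENNReal.ofReal (w.1 ^ m * Real.exp (-(t * w.1)))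
  | Fate.better => {w : ℝ × ℝ | w.2 ≤ w.1}.indicator
      fun w => ENNReal.ofReal (w.1 ^ m * Real.exp (-(T * w.1)))
  | Fate.worse => {w : ℝ × ℝ | w.1 ≤ w.2}.indicator
      fun w => ENNReal.ofReal (w.2 ^ m * Real.exp (-(T * w.2)))

theorem measurable_vertexWeight (t T : ℝ) (m : ℕ) (k : Fate) :
    Measurable (vertexWeight t T m k) := by
  cases k
  · simp only [vertexWeight]; fun_prop
  · exact Measurable.indicator (by fun_prop) (measurableSet_le measurable_snd measurable_fst)
  · exact Measurable.indicator (by fun_prop) (measurableSet_le measurable_fst measurable_snd)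

theorem lintegral_vertexWeight_le {t T : ℝ} (ht : 0 < t) (hT : 0 < T) (m : ℕ) (k : Fate) :
    ∫⁻ w, vertexWeight t T m k w ∂(unitLaw.prod unitLaw) ≤ ENNReal.ofReal
      (match k with
      | Fate.same => m.factorial / t ^ (m + 1)
      | _ => (m + 1).factorial / T ^ (m + 2)) := by
  cases k
  · refine le_trans (le_of_eq ?_) (lintegral_unitLaw_pow_mul_exp_le m ht)
    exact (measurePreserving_fst (μ := unitLaw) (ν := unitLaw)).lintegral_comp
      (f := fun x => ENNReal.ofReal (x ^ m * Real.exp (-(t * x)))) (by fun_prop)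
  · exact lintegral_unitLaw_prod_better_le m hT
  · exact lintegral_unitLaw_prod_worse_le m hT

theorem vertexWeight_eq {V B : Finset (Fin n)} {w : Fin n → ℝ × ℝ} (hw : w ∈ weakRegion V B)
    (t T : ℝ) (m : ℕ) (i : Fin n) :
    vertexWeight t T m (fate V B i) (w i) = ENNReal.ofReal (topValues (fate V B) w i ^ m *
      Real.exp (-((if i ∈ V then T else t) * topValues (fate V B) w i))) := by
  by_cases hi : i ∈ V
  · by_cases hiB : i ∈ B
    · simp only [fate, hi, hiB, if_true, vertexWeight, topValues, Fate.top]
      exact Set.indicator_of_mem (s := {w : ℝ × ℝ | w.2 ≤ w.1}) ((hw i hi).1 hiB) _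
    · simp only [fate, hi, hiB, if_true, if_false, vertexWeight, topValues, Fate.top]
      exact Set.indicator_of_mem (s := {w : ℝ × ℝ | w.1 ≤ w.2}) ((hw i hi).2 hiB) _
  · simp only [fate, hi, if_false, vertexWeight, topValues, Fate.top]

theorem topValues_mem_unit {k : Fin n → Fate} {w : Fin n → ℝ × ℝ}
    (hw : ∀ i, w i ∈ Set.Icc (0 : ℝ) 1 ×ˢ Set.Icc (0 : ℝ) 1) (i : Fin n) :
    topValues k w i ∈ Set.Icc (0 : ℝ) 1 := by
  unfold topValues
  cases k i
  · exact (hw i).1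
  · exact (hw i).1
  · exact (hw i).2

theorem topValues_fate_of_notMem {V B : Finset (Fin n)} (w : Fin n → ℝ × ℝ) {i : Fin n}
    (hi : i ∉ V) : topValues (fate V B) w i = (w i).1 := by
  simp only [topValues, fate, hi, if_false, Fate.top]

theorem prefLaw_blocking_le {M : PerfectMatching n} {V B : Finset (Fin n)}
    (hV : ∀ i, M.partner i ∈ V ↔ i ∈ V) {t T : ℝ} (htn : t ^ 2 = n) {a b : Fin n}
    (hab : a ≠ b) (ha : a ∈ V) (hb : b ∈ V) {w : Fin n → ℝ × ℝ} (hw : w ∈ boundedPairs V B T) :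
    prefLaw n (unblocked (M.outerPairs V) (topValues (fate V B) w) ∩
        blockedAt (upair a b hab) (topValues (fate V B) w)) ≤
      ENNReal.ofReal (Real.exp (n / 2 + 3)) *
        ∏ i, vertexWeight t T (if i = a ∨ i = b then 1 else 0) (fate V B i) (w i) := by
  obtain ⟨hunit, hT, hsq, hreg⟩ := hw
  have hu := topValues_mem_unit (k := fate V B) hunit
  have hout := fun i (hi : i ∉ V) => topValues_fate_of_notMem (B := B) w hi
  simp only [vertexWeight_eq hreg]
  set u := topValues (fate V B) w
  rw [prefLaw_unblocked_inter_blockedAt _ hu (upair_notMem_outerPairs M ha hb hab), mul_upair hab,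
    ← ENNReal.ofReal_prod_of_nonneg fun i _ =>
      mul_nonneg (pow_nonneg (hu i).1 _) (Real.exp_pos _).le,
    ← ENNReal.ofReal_mul (Real.exp_pos _).le, Finset.prod_mul_distrib, ← Real.exp_sum]
  apply ENNReal.ofReal_le_ofReal
  have hprod : ∏ i, u i ^ (if i = a ∨ i = b then 1 else 0) = u a * u b := by
    rw [← Finset.prod_pair hab (f := u), ← Finset.prod_subset (Finset.subset_univ {a, b})]
    · refine Finset.prod_congr rfl fun i hi => ?_
      have : i = a ∨ i = b := by simpa using hi
      simp [this]
    · intro i _ hi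
      have : ¬(i = a ∨ i = b) := by simpa using hi
      simp [this]
  rw [hprod, mul_left_comm, ← Real.exp_add]
  refine mul_le_mul_of_nonneg_left ?_ (mul_nonneg (hu a).1 (hu b).1)
  refine (M.prod_outerPairs_le hV hu).trans (Real.exp_le_exp.2 ?_)
  have e1 : ∑ i ∈ Vᶜ, u i = ∑ i ∈ Vᶜ, (w i).1 :=
    Finset.sum_congr rfl fun i hi => hout i (Finset.mem_compl.1 hi)
  have e2 : ∑ i ∈ Vᶜ, u i ^ 2 = ∑ i ∈ Vᶜ, (w i).1 ^ 2 :=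
    Finset.sum_congr rfl fun i hi => by rw [hout i (Finset.mem_compl.1 hi)]
  have e3 : ∑ i, -((if i ∈ V then T else t) * u i) = -(T * ∑ i ∈ V, u i + t * ∑ i ∈ Vᶜ, u i) := by
    rw [Finset.sum_neg_distrib, ← Finset.sum_add_sum_compl V, Finset.mul_sum, Finset.mul_sum]
    congr 2
    · exact Finset.sum_congr rfl fun i hi => by rw [if_pos hi]
    · exact Finset.sum_congr rfl fun i hi => by rw [if_neg (Finset.mem_compl.1 hi)]
  rw [e3, e2]
  have hUV : 0 ≤ ∑ i ∈ V, u i := Finset.sum_nonneg fun i _ => (hu i).1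
  have hT' : T ≤ ∑ i ∈ Vᶜ, u i := e1 ▸ hT
  have hsq' : ∑ i ∈ Vᶜ, (w i).1 ^ 2 ≤ 3 := hsq
  nlinarith [mul_le_mul_of_nonneg_left hT' hUV, sq_nonneg (∑ i ∈ Vᶜ, u i - t)]

/-- Upper bound for the probability of one orientation and one blocking pair. -/
theorem measure_blocking_le {M : PerfectMatching n} {V B : Finset (Fin n)}
    (hV : ∀ i, M.partner i ∈ V ↔ i ∈ V) {t T : ℝ} (ht : 0 < t) (hT : 0 < T) (htn : t ^ 2 = n)
    {a b : Fin n} (hab : a ≠ b) (ha : a ∈ V) (hb : b ∈ V) :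
    ((pairLaw n).prod (prefLaw n)) {q | q.1 ∈ boundedPairs V B T ∧
        q.2 ∈ unblocked (M.outerPairs V) (topValues (fate V B) q.1) ∩
          blockedAt (upair a b hab) (topValues (fate V B) q.1)} ≤
      ENNReal.ofReal (Real.exp (n / 2 + 3) *
        ((1 / t) ^ (n + V.card) * (t / T) ^ (2 * V.card + 2) * (4 / n))) := by
  have hm := measurableSet_boundedPairs V B T
  rw [prod_apply_fibers (S := fun w => unblocked (M.outerPairs V) (topValues (fate V B) w) ∩
    blockedAt (upair a b hab) (topValues (fate V B) w)) hm
    ((measurableSet_unblocked_topValues _ _).inter (measurableSet_blockedAt_topValues _ _))]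
  refine (setLIntegral_mono' hm fun w hw => prefLaw_blocking_le hV htn hab ha hb hw).trans ?_
  refine (setLIntegral_le_lintegral _ _).trans ?_
  rw [lintegral_const_mul' _ _ ENNReal.ofReal_ne_top, pairLaw,
    lintegral_pi_prod (fun _ : Fin n => unitLaw.prod unitLaw)
      (fun i => vertexWeight t T (if i = a ∨ i = b then 1 else 0) (fate V B i))
      fun i => measurable_vertexWeight _ _ _ _, ENNReal.ofReal_mul (Real.exp_pos _).le]
  refine mul_le_mul_right ?_ _
  have hc : ∀ i, ∫⁻ w, vertexWeight t T (if i = a ∨ i = b then 1 else 0) (fate V B i) w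
      ∂(unitLaw.prod unitLaw) ≤ ENNReal.ofReal ((1 / t * if i ∈ V then 1 / t * (t / T) ^ 2 else 1) *
        if i ∈ ({a, b} : Finset (Fin n)) then 2 / T else 1) := by
    intro i
    refine (lintegral_vertexWeight_le ht hT _ _).trans (le_of_eq ?_)
    congr 1
    simp only [Finset.mem_insert, Finset.mem_singleton]
    by_cases hi : i ∈ V
    · by_cases hiab : i = a ∨ i = b <;> by_cases hiB : i ∈ B <;>
        simp [fate, hi, hiB, hiab, Nat.factorial] <;> field_simp
    · have hiab : ¬(i = a ∨ i = b) := by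
        rintro (rfl | rfl)
        · exact hi ha
        · exact hi hb
      simp [fate, hi, hiab]
  refine (Finset.prod_le_prod' fun i _ => hc i).trans ?_
  rw [← ENNReal.ofReal_prod_of_nonneg]
  · apply ENNReal.ofReal_le_ofReal
    rw [Finset.prod_mul_distrib, Finset.prod_mul_distrib, Finset.prod_ite_mem, Finset.prod_ite_mem,
      Finset.univ_inter, Finset.univ_inter, Finset.prod_const, Finset.prod_const, Finset.prod_const,
      Finset.card_pair hab, Finset.card_univ, Fintype.card_fin, ← htn]
    apply le_of_eq
    rw [mul_pow, pow_add, pow_add (t / T), ← pow_mul]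
    field_simp
    norm_num
  · intro i _
    split_ifs <;> positivity

theorem measure_not_combined_stable_le {M M₁ M₂ M₁₂ : PerfectMatching n}
    (h : IsCombined M M₁ M₂ M₁₂) {T : ℝ} (hn : 0 < n) (hT : 0 < T)
    (hτ : (n : ℝ) ^ (-(1 / 3) : ℝ) ≤ 1)
    (hTle : T ≤ √(n : ℝ) - 10 * Real.log n -
      (M.diffNodes M₁₂).card * ((Real.log n) ^ 2 / √(n : ℝ))) :
    prefLaw n (M.stable ∩ (M₁.stable ∩ M₂.stable ∩ M₁₂.stableᶜ ∩ M.quasirandom)) ≤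
      ENNReal.ofReal ((M.diffNodes M₁).card * ((M.diffNodes M₂).card *
        ((M.orientations M₁).card * ((M.orientations M₂).card * (Real.exp (n / 2 + 3) *
        ((1 / √(n : ℝ)) ^ (n + (M.diffNodes M₁₂).card) *
          (√(n : ℝ) / T) ^ (2 * (M.diffNodes M₁₂).card + 2) * (4 / n))))))) := by
  have hn' : (0 : ℝ) < n := by exact_mod_cast hn
  have ht : 0 < √(n : ℝ) := Real.sqrt_pos.2 hn'
  have htn : √(n : ℝ) ^ 2 = n := Real.sq_sqrt hn'.le
  have hmp := measurePreserving_glue M M₁₂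
  have hEm : MeasurableSet
      (M.stable ∩ (M₁.stable ∩ M₂.stable ∩ M₁₂.stableᶜ ∩ M.quasirandom)) :=
    M.measurableSet_stable.inter (((M₁.measurableSet_stable.inter M₂.measurableSet_stable).inter
      M₁₂.measurableSet_stable.compl).inter M.measurableSet_quasirandom)
  rw [← hmp.measure_preimage hEm.nullMeasurableSet]
  set V := M.diffNodes M₁₂ with hVdef
  set K := Real.exp (n / 2 + 3) * ((1 / √(n : ℝ)) ^ (n + V.card) *
          (√(n : ℝ) / T) ^ (2 * V.card + 2) * (4 / n)) with hK
  have hK0 : 0 ≤ K := by positivity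
  let F : Fin n → Fin n → Finset (Fin n) → Finset (Fin n) → Set ((Fin n → ℝ × ℝ) × PrefArray n) :=
    fun a b B₁ B₂ => {q | ∃ hab : a ≠ b, q.1 ∈ boundedPairs V (B₁ ∪ B₂) T ∧
        q.2 ∈ unblocked (M.outerPairs V) (topValues (fate V (B₁ ∪ B₂)) q.1) ∩
          blockedAt (upair a b hab) (topValues (fate V (B₁ ∪ B₂)) q.1)}
  have hFle : ∀ a ∈ M.diffNodes M₁, ∀ b ∈ M.diffNodes M₂, ∀ B₁ B₂,
      ((pairLaw n).prod (prefLaw n)) (F a b B₁ B₂) ≤ ENNReal.ofReal K := by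
    intro a ha b hb B₁ B₂
    by_cases hab : a ≠ b
    · have haV : a ∈ V := by rw [hVdef, h.diffNodes_eq]; exact Finset.mem_union_left _ ha
      have hbV : b ∈ V := by rw [hVdef, h.diffNodes_eq]; exact Finset.mem_union_right _ hb
      refine (measure_mono fun q hq => ?_).trans (measure_blocking_le (M := M) (B := B₁ ∪ B₂)
        (fun i => partner_mem_diffNodes_iff) ht hT htn hab haV hbV)
      exact hq.2
    · have he : F a b B₁ B₂ = ∅ := Set.eq_empty_of_forall_notMem fun q hq => hab hq.1
      rw [he, measure_empty]
      exact zero_le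
  have hae : ∀ᵐ q ∂((pairLaw n).prod (prefLaw n)),
      ∀ i, q.1 i ∈ Set.Icc (0 : ℝ) 1 ×ˢ Set.Icc (0 : ℝ) 1 :=
    Measure.quasiMeasurePreserving_fst.ae ae_pairLaw_mem_unit
  have hsub : ((fun q : (Fin n → ℝ × ℝ) × PrefArray n => M.glue M₁₂ q.1 q.2) ⁻¹'
      (M.stable ∩ (M₁.stable ∩ M₂.stable ∩ M₁₂.stableᶜ ∩ M.quasirandom)) : Set _) ≤ᵐ[
      (pairLaw n).prod (prefLaw n)] (⋃ a ∈ M.diffNodes M₁, ⋃ b ∈ M.diffNodes M₂,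
        ⋃ B₁ ∈ M.orientations M₁, ⋃ B₂ ∈ M.orientations M₂, F a b B₁ B₂ : Set _) := by
    filter_upwards [hae] with q hq hqE
    obtain ⟨hM, ⟨⟨hM₁, hM₂⟩, hM₁₂⟩, hG⟩ := hqE
    obtain ⟨a, ha, b, hb, B₁, hB₁, B₂, hB₂, hab, haB, hbB, hreg, hY⟩ :=
      exists_of_glue_mem h hM hM₁ hM₂ hM₁₂
    change q ∈ (⋃ a ∈ M.diffNodes M₁, ⋃ b ∈ M.diffNodes M₂,
        ⋃ B₁ ∈ M.orientations M₁, ⋃ B₂ ∈ M.orientations M₂, F a b B₁ B₂ : Set _)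
    simp only [Set.mem_iUnion]
    refine ⟨a, ha, b, hb, B₁, hB₁, B₂, hB₂, hab, ⟨hq, ?_, ?_, hreg⟩, hY⟩
    · obtain ⟨hS, hx, -, -⟩ := hG
      simp only [value_glue_left] at hS hx
      have h1 := (abs_le.1 hS).1
      have h2 : ∑ i ∈ V, (q.1 i).1 ≤ V.card * ((Real.log n) ^ 2 / √(n : ℝ)) :=
        (Finset.sum_le_card_nsmul V _ _ fun i _ => hx i).trans_eq (nsmul_eq_mul _ _)
      rw [← Finset.sum_add_sum_compl V] at h1
      change T ≤ ∑ i ∈ Vᶜ, (q.1 i).1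
      linarith
    · obtain ⟨-, -, -, hsq⟩ := hG
      simp only [value_glue_left] at hsq
      have h1 := (abs_le.1 hsq).2
      rw [← Finset.sum_add_sum_compl V] at h1
      have h2 : 0 ≤ ∑ i ∈ V, (q.1 i).1 ^ 2 := Finset.sum_nonneg fun i _ => sq_nonneg _
      change ∑ i ∈ Vᶜ, (q.1 i).1 ^ 2 ≤ 3
      linarith
  refine (measure_mono_ae hsub).trans ?_
  have hsumle : ∀ {ι : Type} (s : Finset ι) (G : ι → Set ((Fin n → ℝ × ℝ) × PrefArray n)) (c : ℝ),
      0 ≤ c →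
      (∀ i ∈ s, ((pairLaw n).prod (prefLaw n)) (G i) ≤ ENNReal.ofReal c) →
      ((pairLaw n).prod (prefLaw n)) (⋃ i ∈ s, G i) ≤ ENNReal.ofReal (s.card * c) := by
    intro ι s G c hc hG
    refine (measure_biUnion_finset_le s G).trans ((Finset.sum_le_sum hG).trans_eq ?_)
    rw [Finset.sum_const, nsmul_eq_mul, ENNReal.ofReal_mul (by positivity), ENNReal.ofReal_natCast]
  refine hsumle _ _ _ (by positivity) fun a ha => ?_
  refine hsumle _ _ _ (by positivity) fun b hb => ?_
  refine hsumle _ _ _ (by positivity) fun B₁ _ => ?_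
  refine hsumle _ _ _ hK0 fun B₂ _ => ?_
  exact hFle a ha b hb B₁ B₂

theorem exp_sq_le {x : ℝ} (h0 : 0 ≤ x) (h1 : x ≤ 1) : Real.exp (x ^ 2) ≤ 1 + 2 * x ^ 2 := by
  have h := (abs_le.1 (Real.abs_exp_sub_one_sub_id_le (x := x ^ 2) (by
    rw [abs_of_nonneg (sq_nonneg x)]; nlinarith))).2
  have h2 : x ^ 2 ≤ 1 := pow_le_one₀ h0 h1
  nlinarith [mul_le_mul_of_nonneg_left h2 (sq_nonneg x)]

theorem lintegral_exp_sq_sub_le {t : ℝ} (ht : 0 < t) :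
    ∫⁻ w, ENNReal.ofReal (Real.exp (w.1 ^ 2 - t * w.1)) ∂(unitLaw.prod unitLaw) ≤
      ENNReal.ofReal (1 / t * Real.exp (4 / t ^ 2)) := by
  rw [(measurePreserving_fst (μ := unitLaw) (ν := unitLaw)).lintegral_comp
      (f := fun x => ENNReal.ofReal (Real.exp (x ^ 2 - t * x))) (by fun_prop)]
  have hae : ∀ᵐ x ∂unitLaw, x ∈ Set.Icc (0 : ℝ) 1 := ae_restrict_mem measurableSet_Icc
  have hle : ∀ᵐ x ∂unitLaw, ENNReal.ofReal (Real.exp (x ^ 2 - t * x)) ≤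
      ENNReal.ofReal (x ^ 0 * Real.exp (-(t * x))) +
        ENNReal.ofReal 2 * ENNReal.ofReal (x ^ 2 * Real.exp (-(t * x))) := by
    filter_upwards [hae] with x hx
    rw [← ENNReal.ofReal_mul (by norm_num), ← ENNReal.ofReal_add (by positivity) (by positivity)]
    apply ENNReal.ofReal_le_ofReal
    rw [sub_eq_add_neg, Real.exp_add]
    have := exp_sq_le hx.1 hx.2
    nlinarith [Real.exp_pos (-(t * x))]
  refine (lintegral_mono_ae hle).trans ?_
  rw [lintegral_add_left (by fun_prop), lintegral_const_mul _ (by fun_prop)]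
  refine (add_le_add (lintegral_unitLaw_pow_mul_exp_le 0 ht)
    (mul_le_mul_right (lintegral_unitLaw_pow_mul_exp_le 2 ht) _)).trans ?_
  rw [← ENNReal.ofReal_mul (by norm_num), ← ENNReal.ofReal_add (by positivity) (by positivity)]
  apply ENNReal.ofReal_le_ofReal
  have h1 : ((0 : ℕ).factorial : ℝ) / t ^ (0 + 1) + 2 * ((2 : ℕ).factorial / t ^ (2 + 1)) =
      1 / t * (4 / t ^ 2 + 1) := by
    simp only [Nat.factorial]
    push_cast
    field_simp
    ring
  rw [h1]
  exact mul_le_mul_of_nonneg_left (Real.add_one_le_exp _) (by positivity)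

/-- Upper bound for the probability that `M` is stable. -/
theorem prefLaw_stable_le (M : PerfectMatching n) (hn : 0 < n) :
    prefLaw n M.stable ≤ ENNReal.ofReal (Real.exp (n / 2 + 4) * (1 / √(n : ℝ)) ^ n) := by
  have hn' : (0 : ℝ) < n := by exact_mod_cast hn
  have ht : 0 < √(n : ℝ) := Real.sqrt_pos.2 hn'
  have htn : √(n : ℝ) ^ 2 = n := Real.sq_sqrt hn'.le
  have hmp := measurePreserving_glue M M
  rw [← hmp.measure_preimage M.measurableSet_stable.nullMeasurableSet]
  let k : Fin n → Fate := fate ∅ ∅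
  have hk : ∀ w i, topValues k w i = (w i).1 := fun w i =>
    topValues_fate_of_notMem w (Finset.notMem_empty i)
  have hsub : (fun q : (Fin n → ℝ × ℝ) × PrefArray n => M.glue M q.1 q.2) ⁻¹' M.stable ⊆
      {q | q.1 ∈ Set.univ ∧ q.2 ∈ unblocked (M.outerPairs ∅) (topValues k q.1)} := by
    rintro q hq
    refine ⟨trivial, ?_⟩
    rintro ⟨⟨i, j⟩, hij⟩ hp
    have hij' : i < j := hij
    simp only [outerPairs, Finset.mem_filter, Finset.mem_univ, true_and] at hp
    have hst : M.glue M q.1 q.2 ∈ M.stable := hq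
    have := hst i j hij'.ne hp.1
    rw [value_glue_left, value_glue_left, glue_other _ _ _ _ _ hp.1 hp.1,
      glue_other _ _ _ _ _ (M.partner_ne_symm hp.1) (M.partner_ne_symm hp.1)] at this
    simpa only [pairEntries, hk, not_and_or, not_le] using this
  refine (measure_mono hsub).trans ?_
  rw [prod_apply_fibers (S := fun w => unblocked (M.outerPairs ∅) (topValues k w))
    MeasurableSet.univ (measurableSet_unblocked_topValues _ _), Measure.restrict_univ]
  have hle : ∀ᵐ w ∂(pairLaw n), prefLaw n (unblocked (M.outerPairs ∅) (topValues k w)) ≤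
      ENNReal.ofReal (Real.exp (n / 2)) *
        ∏ i, ENNReal.ofReal (Real.exp ((w i).1 ^ 2 - √(n : ℝ) * (w i).1)) := by
    filter_upwards [ae_pairLaw_mem_unit] with w hw
    have hu := topValues_mem_unit (k := k) hw
    rw [prefLaw_unblocked _ hu, ← ENNReal.ofReal_prod_of_nonneg fun i _ => (Real.exp_pos _).le,
      ← Real.exp_sum, ← ENNReal.ofReal_mul (Real.exp_pos _).le, ← Real.exp_add]
    apply ENNReal.ofReal_le_ofReal
    refine (M.prod_outerPairs_le (by simp) hu).trans (Real.exp_le_exp.2 ?_)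
    simp only [Finset.compl_empty, Finset.sum_empty, zero_mul, sub_zero, hk,
      Finset.sum_sub_distrib, ← Finset.mul_sum]
    nlinarith [sq_nonneg (∑ i, (w i).1 - √(n : ℝ))]
  refine (lintegral_mono_ae hle).trans ?_
  rw [lintegral_const_mul' _ _ ENNReal.ofReal_ne_top, pairLaw,
    lintegral_pi_prod (fun _ : Fin n => unitLaw.prod unitLaw)
      (fun _ w => ENNReal.ofReal (Real.exp (w.1 ^ 2 - √(n : ℝ) * w.1))) fun i => by fun_prop]
  refine (mul_le_mul_right (Finset.prod_le_prod' fun i _ => lintegral_exp_sq_sub_le ht) _).trans ?_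
  rw [Finset.prod_const, Finset.card_univ, Fintype.card_fin, ← ENNReal.ofReal_pow (by positivity),
    ← ENNReal.ofReal_mul (Real.exp_pos _).le]
  apply ENNReal.ofReal_le_ofReal
  rw [mul_pow, ← Real.exp_nat_mul, htn, Real.exp_add, show (n : ℝ) * (4 / n) = 4 by field_simp]
  apply le_of_eq
  ring

end PerfectMatching

namespace PerfectMatching

variable {n : ℕ}

instance : Finite (PerfectMatching n) :=
  Finite.of_injective partner fun _ _ h => PerfectMatching.ext h

theorem card_diffNodes_le (M N : PerfectMatching n) :
    (M.diffNodes N).card ≤ 2 * (symmDiff N.edges M.edges).card := by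
  refine Finset.card_le_mul_card_image_of_maps_to (f := fun i => s(i, N.partner i)) ?_ 2 ?_
  · intro i hi
    rw [mem_diffNodes] at hi
    rw [Finset.mem_symmDiff]
    left
    rw [mem_edges, mem_edges]
    exact ⟨rfl, hi.symm⟩
  · intro e _
    induction e using Sym2.ind with
    | _ x y =>
      refine (Finset.card_le_card (t := {x, y}) fun i hi => ?_).trans Finset.card_le_two
      simp only [Finset.mem_filter, Sym2.eq_iff] at hi
      rcases hi.2 with h | h <;> simp [h.1]

theorem condProb_eq (M : PerfectMatching n) (E : Set (PrefArray n)) :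
    M.condProb E = ((prefLaw n).real M.stable)⁻¹ * (prefLaw n).real (M.stable ∩ E) := by
  rw [condProb, measureReal_def, cond_apply M.measurableSet_stable, ENNReal.toReal_mul,
    ENNReal.toReal_inv]
  rfl

theorem condProb_nonneg (M : PerfectMatching n) (E : Set (PrefArray n)) : 0 ≤ M.condProb E :=
  measureReal_nonneg

theorem IsCombined.card_diffNodes {M M₁ M₂ M₁₂ : PerfectMatching n}
    (h : IsCombined M M₁ M₂ M₁₂) :
    (M.diffNodes M₁₂).card = (M.diffNodes M₁).card + (M.diffNodes M₂).card := by
  rw [h.diffNodes_eq, Finset.card_union_of_disjoint h.disjoint]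

theorem div_pow_le_exp_one {t d : ℝ} (ht : 0 < t) (hd0 : 0 ≤ d) (hd : 2 * d ≤ t) (m : ℕ)
    (hm : m * (2 * d) ≤ t) : (t / (t - d)) ^ m ≤ Real.exp 1 := by
  have hT : 0 < t - d := by linarith
  have h1 : t / (t - d) ≤ Real.exp (2 * d / t) := by
    refine le_trans ?_ (Real.add_one_le_exp _)
    rw [div_le_iff₀ hT]
    have : (2 * d / t + 1) * (t - d) = t + d * (t - 2 * d) / t := by field_simp; ring
    rw [this]
    have : 0 ≤ d * (t - 2 * d) / t := div_nonneg (mul_nonneg hd0 (by linarith)) ht.le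
    linarith
  calc (t / (t - d)) ^ m ≤ Real.exp (2 * d / t) ^ m :=
        pow_le_pow_left₀ (div_nonneg ht.le hT.le) h1 m
    _ = Real.exp (m * (2 * d / t)) := (Real.exp_nat_mul _ _).symm
    _ ≤ Real.exp 1 := by
        apply Real.exp_le_exp.2
        rw [← mul_div_assoc, div_le_one ht]
        exact hm

theorem deviation_bounds {y ℓ L v : ℝ} (hℓ : 6 ≤ ℓ) (hy : 3840 ≤ y) (hly : 220 * ℓ ^ 2 ≤ y)
    (hL0 : 0 ≤ L) (hLy : 220 * y * L ≤ 1) (hv0 : 0 ≤ v) (hv : v ≤ 4 * y) :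
    0 ≤ 10 * ℓ + v * L ∧ 2 * (10 * ℓ + v * L) ≤ y ^ 2 ∧
      (2 * v + 2) * (2 * (10 * ℓ + v * L)) ≤ y ^ 2 := by
  have hvL0 : 0 ≤ v * L := mul_nonneg hv0 hL0
  have hvL : v * L ≤ 1 := by
    have := mul_le_mul_of_nonneg_right hv hL0
    linarith
  have hℓy : 1320 * ℓ ≤ y := by nlinarith
  have hd : 2 * (10 * ℓ + v * L) ≤ y / 60 := by linarith
  refine ⟨by linarith, by nlinarith, ?_⟩
  have h1 : 2 * v + 2 ≤ 10 * y := by linarith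
  calc (2 * v + 2) * (2 * (10 * ℓ + v * L)) ≤ 10 * y * (y / 60) :=
        mul_le_mul h1 hd (by linarith) (by linarith)
    _ ≤ y ^ 2 := by nlinarith

theorem inv_mul_le_of_bounds {n v₁ v₂ : ℕ} {t c₁ c₂ o₁ o₂ p s P₁ P₂ q : ℝ} (ht : 0 < t)
    (hc₁ : 0 ≤ c₁) (hc₂ : 0 ≤ c₂) (ho₁ : 0 ≤ o₁) (ho₂ : 0 ≤ o₂)
    (hq : q ≤ Real.exp 1)
    (hp : p ≤ c₁ * (c₂ * (o₁ * (o₂ * (Real.exp (n / 2 + 3) *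
      ((1 / t) ^ (n + (v₁ + v₂)) * q * (4 / n)))))))
    (hs0 : 0 ≤ s) (hs : s ≤ Real.exp (n / 2 + 4) * (1 / t) ^ n)
    (h₁ : o₁ * (Real.exp (n / 2 - 77) * (1 / t) ^ (n + v₁) * (1 / 2)) ≤ P₁)
    (h₂ : o₂ * (Real.exp (n / 2 - 77) * (1 / t) ^ (n + v₂) * (1 / 2)) ≤ P₂) :
    s⁻¹ * p ≤ c₁ * c₂ * (16 * Real.exp 162) / n * (s⁻¹ * P₁ * (s⁻¹ * P₂)) := by
  rcases hs0.eq_or_lt with hs0 | hs0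
  · rw [← hs0]; simp
  have hp' : p ≤ c₁ * (c₂ * (o₁ * (o₂ * (Real.exp (n / 2 + 3) *
      ((1 / t) ^ (n + (v₁ + v₂)) * Real.exp 1 * (4 / n)))))) := hp.trans (by gcongr)
  have h₁0 := le_trans (by positivity) h₁
  have hkey : p * s ≤ c₁ * c₂ * (16 * Real.exp 162) / n * (P₁ * P₂) := by
    have hp1 := mul_le_mul hp' hs hs0.le (by positivity)
    have hp2 := mul_le_mul h₁ h₂ (by positivity) h₁0
    refine hp1.trans (le_trans (le_of_eq ?_) (mul_le_mul_of_nonneg_left hp2 (by positivity)))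
    have ea : Real.exp (n / 2 + 3) * Real.exp 1 * Real.exp (n / 2 + 4) =
        Real.exp 162 * (Real.exp (n / 2 - 77) * Real.exp (n / 2 - 77)) := by
      rw [← Real.exp_add, ← Real.exp_add, ← Real.exp_add, ← Real.exp_add]
      congr 1
      ring
    have eb : (1 / t) ^ (n + (v₁ + v₂)) * (1 / t) ^ n = (1 / t) ^ (n + v₁) * (1 / t) ^ (n + v₂) := by
      rw [← pow_add, ← pow_add]
      congr 1
      ring
    calc _ = c₁ * c₂ * (o₁ * o₂) * (4 / n) *
          (Real.exp (n / 2 + 3) * Real.exp 1 * Real.exp (n / 2 + 4)) *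
          ((1 / t) ^ (n + (v₁ + v₂)) * (1 / t) ^ n) := by ring
      _ = _ := by rw [ea, eb]; ring
  calc s⁻¹ * p = s⁻¹ * s⁻¹ * (p * s) := by field_simp
    _ ≤ s⁻¹ * s⁻¹ * (c₁ * c₂ * (16 * Real.exp 162) / n * (P₁ * P₂)) :=
        mul_le_mul_of_nonneg_left hkey (by positivity)
    _ = _ := by ring

theorem condProb_le_of_large {M M₁ M₂ M₁₂ : PerfectMatching n} (h : IsCombined M M₁ M₂ M₁₂)
    {y : ℝ} (hy : y = (n : ℝ) ^ (1 / 4 : ℝ)) (hlog : 6 ≤ Real.log n) (hy0 : 3840 ≤ y)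
    (hly : 220 * (Real.log n) ^ 2 ≤ y)
    (h1 : ((M.diffNodes M₁).card : ℝ) ≤ 2 * y) (h2 : ((M.diffNodes M₂).card : ℝ) ≤ 2 * y) :
    M.condProb (M₁.stable ∩ M₂.stable ∩ M₁₂.stableᶜ ∩ M.quasirandom) ≤
      (M.diffNodes M₁).card * (M.diffNodes M₂).card * (16 * Real.exp 162) / n *
        (M.condProb (M₁.stable ∩ M.quasirandom) * M.condProb (M₂.stable ∩ M.quasirandom)) := by
  have hn : 0 < n := by
    rcases Nat.eq_zero_or_pos n with h0 | h0
    · subst h0; simp at hlog; norm_num at hlog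
    · exact h0
  have hn' : (0 : ℝ) < n := by exact_mod_cast hn
  set ℓ := Real.log n
  set t := √(n : ℝ) with htdef
  have ht : 0 < t := Real.sqrt_pos.2 hn'
  have htn : t ^ 2 = n := Real.sq_sqrt hn'.le
  have hty : t = y ^ 2 := by
    rw [htdef, Real.sqrt_eq_rpow, hy, ← Real.rpow_natCast, ← Real.rpow_mul hn'.le]
    norm_num
  have hny : (n : ℝ) = y ^ 4 := by rw [← htn, hty]; ring
  have hn1 : (1 : ℝ) ≤ n := by rw [hny]; exact one_le_pow₀ (by linarith)
  set L := ℓ ^ 2 / t with hL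
  set τ := (n : ℝ) ^ (-(1 / 3) : ℝ) with hτ
  have hτ1 : τ ≤ 1 := Real.rpow_le_one_of_one_le_of_nonpos hn1 (by norm_num)
  have hL0 : 0 ≤ L := by positivity
  have hLy : 220 * y * L ≤ 1 := by
    rw [hL, hty, ← mul_div_assoc, div_le_one (by positivity)]
    nlinarith
  have hL2 : L ≤ 1 / 2 := by nlinarith
  have hτn : y ^ 2 ≤ τ * n := by
    rw [hτ, ← Real.rpow_add_one hn'.ne', hy, ← Real.rpow_natCast, ← Real.rpow_mul hn'.le]
    exact Real.rpow_le_rpow_of_exponent_le hn1 (by norm_num)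
  have hτn2 : y ≤ τ ^ 2 * n := by
    rw [hτ, ← Real.rpow_natCast, ← Real.rpow_mul hn'.le, ← Real.rpow_add_one hn'.ne', hy]
    exact Real.rpow_le_rpow_of_exponent_le hn1 (by norm_num)
  have hexp : 32 * (n * Real.exp (-(t * L / 2))) ≤ 1 := by
    have e1 : t * L = ℓ ^ 2 := by rw [hL]; field_simp
    have e2 : (n : ℝ) = Real.exp ℓ := (Real.exp_log hn').symm
    rw [e1]
    nth_rewrite 1 [e2]
    rw [← Real.exp_add]
    have e3 : Real.exp (ℓ + -(ℓ ^ 2 / 2)) ≤ Real.exp (-12) := Real.exp_le_exp.2 (by nlinarith)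
    have e4 : (32 : ℝ) ≤ Real.exp 12 := by
      have := Real.add_one_le_exp (12 / 2 : ℝ)
      have e5 : Real.exp 12 = Real.exp (12 / 2) ^ 2 := by
        rw [← Real.exp_nat_mul]; norm_num
      rw [e5]; nlinarith
    rw [Real.exp_neg] at e3
    have e6 : 32 * (Real.exp 12)⁻¹ ≤ 1 := by
      rw [← div_eq_mul_inv, div_le_one (Real.exp_pos _)]; exact e4
    linarith
  have hlower : ∀ N : PerfectMatching n, ((M.diffNodes N).card : ℝ) ≤ 2 * y →
      (M.orientations N).card * (Real.exp (n / 2 - 77) *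
        (1 / t) ^ (n + (M.diffNodes N).card) * (1 / 2)) ≤
      (prefLaw n).real (M.stable ∩ (N.stable ∩ M.quasirandom)) := by
    intro N hN
    have := measure_stable_inter_ge (M := M) (N := N) hn hL hτ (by linarith) hL2
      ((mul_le_mul_of_nonneg_right hN hL0).trans (by nlinarith)) hτ1
      (hN.trans (by rw [← htdef, hty]; nlinarith)) (by nlinarith) (by linarith) hexp
    exact (ENNReal.ofReal_le_iff_le_toReal (measure_ne_top _ _)).1 this
  have hlow1 := hlower M₁ h1
  have hlow2 := hlower M₂ h2
  have hPS : (prefLaw n).real M.stable ≤ Real.exp (n / 2 + 4) * (1 / t) ^ n :=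
    ENNReal.toReal_le_of_le_ofReal (by positivity) (prefLaw_stable_le M hn)
  have hvy : (((M.diffNodes M₁₂).card : ℕ) : ℝ) ≤ 4 * y := by
    rw [h.card_diffNodes]; push_cast; linarith
  obtain ⟨hd0, hdt, hdv⟩ := deviation_bounds hlog hy0 hly hL0 hLy (Nat.cast_nonneg _) hvy
  rw [← hty] at hdt hdv
  have hpow := div_pow_le_exp_one ht hd0 hdt (2 * (M.diffNodes M₁₂).card + 2)
    (by push_cast; exact hdv)
  have hlogn : 0 ≤ ℓ := by linarith
  have hT : 0 < t - (10 * ℓ + (M.diffNodes M₁₂).card * L) := by linarith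
  have hup := measure_not_combined_stable_le h hn hT hτ1 (by linarith)
  rw [condProb_eq, condProb_eq, condProb_eq]
  refine inv_mul_le_of_bounds (c₁ := (M.diffNodes M₁).card) (c₂ := (M.diffNodes M₂).card)
    (o₁ := (M.orientations M₁).card) (o₂ := (M.orientations M₂).card) ht (Nat.cast_nonneg _)
    (Nat.cast_nonneg _) (Nat.cast_nonneg _) (Nat.cast_nonneg _) hpow ?_
    measureReal_nonneg hPS hlow1 hlow2
  rw [← h.card_diffNodes]
  refine ENNReal.toReal_le_of_le_ofReal ?_ hup
  have : 0 ≤ t / (t - (10 * ℓ + (M.diffNodes M₁₂).card * L)) := div_nonneg ht.le hT.le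
  exact mul_nonneg (Nat.cast_nonneg _) (mul_nonneg (Nat.cast_nonneg _)
    (mul_nonneg (Nat.cast_nonneg _) (mul_nonneg (Nat.cast_nonneg _) (mul_nonneg (Real.exp_pos _).le
      (mul_nonneg (mul_nonneg (pow_nonneg (one_div_nonneg.2 ht.le) _) (pow_nonneg this _))
        (div_nonneg (by norm_num) hn'.le))))))

theorem eventually_log_le :
    ∀ᶠ n : ℕ in atTop, 6 ≤ Real.log n ∧ 3840 ≤ (n : ℝ) ^ (1 / 4 : ℝ) ∧
      220 * (Real.log n) ^ 2 ≤ (n : ℝ) ^ (1 / 4 : ℝ) := by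
  have hcast := tendsto_natCast_atTop_atTop (R := ℝ)
  have h1 := hcast.eventually (Real.tendsto_log_atTop.eventually_ge_atTop 6)
  have h2 := hcast.eventually
    ((tendsto_rpow_atTop (y := (1 / 4 : ℝ)) (by norm_num)).eventually_ge_atTop 3840)
  have h3 := hcast.eventually ((isLittleO_log_rpow_atTop (r := (1 / 8 : ℝ)) (by norm_num)).bound
    (c := 1 / 15) (by norm_num))
  filter_upwards [h1, h2, h3] with n h1 h2 h3
  refine ⟨h1, h2, ?_⟩
  have hn : (0 : ℝ) ≤ n := Nat.cast_nonneg n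
  rw [Real.norm_of_nonneg (by linarith), Real.norm_of_nonneg (by positivity)] at h3
  have h4 : (n : ℝ) ^ (1 / 4 : ℝ) = ((n : ℝ) ^ (1 / 8 : ℝ)) ^ 2 := by
    rw [← Real.rpow_natCast, ← Real.rpow_mul hn]
    norm_num
  rw [h4]
  nlinarith [Real.rpow_nonneg hn (1 / 8)]

/-- For every single `n` the claimed bound holds if the exponent is large enough. -/
theorem eventually_condProb_le (n : ℕ) (β : ℝ) :
    ∀ᶠ e : ℝ in atTop, ∀ M M₁ M₂ M₁₂ : PerfectMatching n,
      M.condProb (M₁.stable ∩ M₂.stable ∩ M₁₂.stableᶜ ∩ M.quasirandom) ≤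
        (n : ℝ) ^ (β + e) *
          (M.condProb (M₁.stable ∩ M.quasirandom) * M.condProb (M₂.stable ∩ M.quasirandom)) := by
  simp only [Filter.eventually_all]
  intro M M₁ M₂ M₁₂
  rcases Nat.lt_or_ge n 2 with hn | hn
  · refine Eventually.of_forall fun e => ?_
    have hsub : Subsingleton (Fin n) := Fin.subsingleton_iff_le_one.2 (by omega)
    have hM : M₁₂ = M₁ := by
      ext i
      rw [Subsingleton.elim (M₁₂.partner i) (M₁.partner i)]
    have : M₁.stable ∩ M₂.stable ∩ M₁₂.stableᶜ ∩ M.quasirandom = ∅ := by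
      rw [hM]
      ext X
      simp only [Set.mem_inter_iff, Set.mem_compl_iff, Set.mem_empty_iff_false, iff_false]
      tauto
    rw [this]
    simp only [condProb, measureReal_empty]
    positivity
  · have hn1 : (1 : ℝ) < n := by exact_mod_cast hn
    set p := M.condProb (M₁.stable ∩ M₂.stable ∩ M₁₂.stableᶜ ∩ M.quasirandom)
    set p₁ := M.condProb (M₁.stable ∩ M.quasirandom)
    set p₂ := M.condProb (M₂.stable ∩ M.quasirandom)
    have h1 : p ≤ p₁ := measureReal_mono fun X hX => ⟨hX.1.1.1, hX.2⟩
    have h2 : p ≤ p₂ := measureReal_mono fun X hX => ⟨hX.1.1.2, hX.2⟩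
    have hp0 : 0 ≤ p := M.condProb_nonneg _
    rcases hp0.eq_or_lt with hp | hp
    · refine Eventually.of_forall fun e => ?_
      rw [← hp]
      have := M.condProb_nonneg (M₁.stable ∩ M.quasirandom)
      have := M.condProb_nonneg (M₂.stable ∩ M.quasirandom)
      positivity
    · have hpp : 0 < p₁ * p₂ := mul_pos (hp.trans_le h1) (hp.trans_le h2)
      have htend : Tendsto (fun e : ℝ => (n : ℝ) ^ (β + e)) atTop atTop :=
        (tendsto_rpow_atTop_of_base_gt_one _ hn1).comp (tendsto_atTop_add_const_left _ β tendsto_id)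
      filter_upwards [htend.eventually_ge_atTop (p / (p₁ * p₂))] with e he
      exact (div_le_iff₀ hpp).1 he

end PerfectMatching

theorem mainTheorem4 :
    ∀ α : ℝ, α < 1 / 4 →
      ∃ ε : ℕ → ℝ, Tendsto ε atTop (𝓝 0) ∧
        ∀ (n : ℕ) (M M₁ M₂ M₁₂ : PerfectMatching n),
          Disjoint (M.diffNodes M₁) (M.diffNodes M₂) →
          ((symmDiff M₁.edges M.edges).card : ℝ) ≤ (n : ℝ) ^ α →
          ((symmDiff M₂.edges M.edges).card : ℝ) ≤ (n : ℝ) ^ α →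
          symmDiff M₁₂.edges M.edges =
            symmDiff M₁.edges M.edges ∪ symmDiff M₂.edges M.edges →
          M.condProb (M₁.stable ∩ M₂.stable ∩ M₁₂.stableᶜ ∩ M.quasirandom) ≤
            (n : ℝ) ^ (-1 + 2 * α + ε n) *
              (M.condProb (M₁.stable ∩ M.quasirandom) *
                M.condProb (M₂.stable ∩ M.quasirandom)) := by
  intro α hα
  obtain ⟨N, hN⟩ := eventually_atTop.1 PerfectMatching.eventually_log_le
  let K : ℝ := 64 * Real.exp 162
  have hK : 0 < K := by positivity
  choose e he using fun n => (PerfectMatching.eventually_condProb_le n (-1 + 2 * α)).exists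
  refine ⟨fun n => if N ≤ n then Real.log K / Real.log n else e n, ?_, ?_⟩
  · have h0 : Tendsto (fun n : ℕ => Real.log K / Real.log n) atTop (𝓝 0) :=
      (Real.tendsto_log_atTop.comp tendsto_natCast_atTop_atTop).const_div_atTop _
    refine h0.congr' ?_
    filter_upwards [eventually_ge_atTop N] with n hn
    rw [if_pos hn]
  · intro n M M₁ M₂ M₁₂ hd h1 h2 hs
    by_cases hn : N ≤ n
    · simp only [if_pos hn]
      obtain ⟨hlog, hy, hly⟩ := hN n hn
      have hn0 : (0 : ℝ) < n := by
        rcases Nat.eq_zero_or_pos n with h0 | h0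
        · subst h0; simp at hlog; norm_num at hlog
        · exact_mod_cast h0
      have hn1 : (1 : ℝ) ≤ n := by
        by_contra hc
        have := Real.log_neg hn0 (not_le.1 hc)
        linarith
      have hαy : (n : ℝ) ^ α ≤ (n : ℝ) ^ (1 / 4 : ℝ) :=
        Real.rpow_le_rpow_of_exponent_le hn1 hα.le
      have hv : ∀ M' : PerfectMatching n, ((symmDiff M'.edges M.edges).card : ℝ) ≤ (n : ℝ) ^ α →
          ((M.diffNodes M').card : ℝ) ≤ 2 * (n : ℝ) ^ α := fun M' h => by
        have : ((M.diffNodes M').card : ℝ) ≤ 2 * (symmDiff M'.edges M.edges).card := by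
          exact_mod_cast M.card_diffNodes_le M'
        linarith
      have hv1 := hv M₁ h1
      have hv2 := hv M₂ h2
      refine (PerfectMatching.condProb_le_of_large ⟨hd, hs⟩ rfl hlog hy hly (by linarith)
        (by linarith)).trans ?_
      refine mul_le_mul_of_nonneg_right ?_
        (mul_nonneg (M.condProb_nonneg _) (M.condProb_nonneg _))
      have hpow : (n : ℝ) ^ (-1 + 2 * α + Real.log K / Real.log n) =
          (n : ℝ) ^ α * (n : ℝ) ^ α * K / n := by
        have hKn : (n : ℝ) ^ (Real.log K / Real.log n) = K := by
          rw [Real.rpow_def_of_pos hn0, mul_div_cancel₀ _ (by linarith), Real.exp_log hK]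
        rw [Real.rpow_add hn0, hKn, Real.rpow_add hn0, Real.rpow_neg_one, two_mul,
          Real.rpow_add hn0]
        ring
      rw [hpow]
      have hmul := mul_le_mul hv1 hv2 (Nat.cast_nonneg _) (by positivity)
      refine div_le_div_of_nonneg_right ?_ hn0.le
      calc _ ≤ 2 * (n : ℝ) ^ α * (2 * (n : ℝ) ^ α) * (16 * Real.exp 162) :=
            mul_le_mul_of_nonneg_right hmul (by positivity)
        _ = _ := by simp only [K]; ring
    · simp only [if_neg hn]
      exact he n M M₁ M₂ M₁₂
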